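/- Let $E$ be a separable symmetric sequence space, that is, a linear space of real sequences with $\ell_1\subseteq E\subseteq\ell_\infty$, complete and separable in its own norm, such that whenever $x\in E$, $y\in\ell_\infty$ and the decreasing rearrangements satisfy $y^*\le x^*$, then $y\in E$ and $\|y\|_E\le\|x\|_E$. Let $H$ be a complex Hilbert space, and let $S_E(H)$ be the real ordered Banach space of self-adjoint bounded operators $x$ on $H$ whose sequence of singular values $(s_n(x))_{n\ge0}$ lies in $E$, with the norm $\|x\|=\|(s_n(x))_n\|_E$ and the cone of positive operators. Here $s_n(x)$ is the infimum of $\|xe\|$ over the orthogonal projections $e$ such that $1-e$ has rank at most $n$. Operators are bounded and real-linear; $0\le T\le S$ means $0\le Tx\le Sx$ for all $x\ge0$; and $E$ contains $\ell_1$ if some closed subspace of $E$ is linearly homeomorphic to $\ell_1$. (1) Suppose that $E$ does not contain $\ell_1$. Let $Z$ be a real Banach space ordered by a closed proper convex cone that is normal, i.e. there is a constant $N$ with $\|z\|\le N(\|a\|+\|b\|)$ whenever $a\le z\le b$ in $Z$. If operators $T,S:S_E(H)\to Z$ satisfy $0\le T\le S$ and the Banach space adjoint $S^\star:Z^\star\to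 S_E(H)^\star$ is compact, then $T^\star$ is compact. (2) Conversely, suppose that $E$ contains $\ell_1$, that $H$ is infinite-dimensional, and that $Z$ is a real Banach lattice that is either not atomic or not order continuous. ($Z$ is atomic if every $z>0$ dominates an atom, i.e. an $a>0$ such that every $b$ with $0\le b\le a$ is a scalar multiple of $a$; $Z$ is order continuous if every net in $Z$ that decreases to $0$ tends to $0$ in norm.) Then there exist operators $T,S:S_E(H)\to Z$ with $0\le T\le S$ such that $S$ is compact and $T$ is not compact. -/

import Mathlib

open Set Filter Topology

noncomputable section

/-- The decreasing rearrangement of a bounded real sequence: `decRearr x n` is the infimum, over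
sets `F` of at most `n` indices, of the supremum of `|x|` off `F`. -/
def decRearr (x : ℕ → ℝ) (n : ℕ) : ℝ :=
  ⨅ F : {F : Finset ℕ // F.card ≤ n}, ⨆ k : {k : ℕ // k ∉ F.1}, |x k|

/-- A (real) symmetric sequence space on `ℕ`: a linear space `carrier` of sequences with
`ℓ₁ ⊆ carrier ⊆ ℓ_∞`, complete in its own norm, such that whenever `x` is in the space and the
decreasing rearrangement of `y` is dominated by that of `x`, then `y` is in the space, with
`‖y‖ ≤ ‖x‖`. The values of `norm` outside `carrier` play no role. -/
structure SymmetricSequenceSpace where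
  carrier : Submodule ℝ (ℕ → ℝ)
  norm : (ℕ → ℝ) → ℝ
  norm_add_le : ∀ x ∈ carrier, ∀ y ∈ carrier, norm (x + y) ≤ norm x + norm y
  norm_smul : ∀ (c : ℝ), ∀ x ∈ carrier, norm (c • x) = |c| * norm x
  eq_zero_of_norm_eq_zero : ∀ x ∈ carrier, norm x = 0 → x = 0
  complete : ∀ u : ℕ → ℕ → ℝ, (∀ i, u i ∈ carrier) →
    (∀ ε > 0, ∃ N, ∀ i ≥ N, ∀ j ≥ N, norm (u i - u j) < ε) →
    ∃ x ∈ carrier, ∀ ε > 0, ∃ N, ∀ i ≥ N, norm (u i - x) < ε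
  mem_of_summable : ∀ x : ℕ → ℝ, Summable (fun n => |x n|) → x ∈ carrier
  bounded_of_mem : ∀ x ∈ carrier, ∃ C, ∀ n, |x n| ≤ C
  symmetric : ∀ x ∈ carrier, ∀ y : ℕ → ℝ, (∃ C, ∀ n, |y n| ≤ C) →
    (∀ n, decRearr y n ≤ decRearr x n) → y ∈ carrier ∧ norm y ≤ norm x

section rearrangement

theorem decRearr_le {x : ℕ → ℝ} {n : ℕ} {F : Finset ℕ} (hF : F.card ≤ n) {s : ℝ} (hs : 0 ≤ s)
    (h : ∀ k ∉ F, |x k| ≤ s) : decRearr x n ≤ s := by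
  refine ciInf_le_of_le ⟨0, ?_⟩ ⟨F, hF⟩ (Real.iSup_le (fun k => h k k.2) hs)
  rintro _ ⟨G, rfl⟩
  exact Real.iSup_nonneg fun k => abs_nonneg _

theorem le_decRearr {x : ℕ → ℝ} {n : ℕ} {s : ℝ}
    (h : ∀ F : Finset ℕ, F.card ≤ n → s ≤ ⨆ k : {k : ℕ // k ∉ F}, |x k|) : s ≤ decRearr x n := by
  have : Nonempty {F : Finset ℕ // F.card ≤ n} := ⟨⟨∅, by simp⟩⟩
  exact le_ciInf fun F => h F.1 F.2

theorem decRearr_nonneg (x : ℕ → ℝ) (n : ℕ) : 0 ≤ decRearr x n :=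
  le_decRearr fun _ _ => Real.iSup_nonneg fun _ => abs_nonneg _

theorem decRearr_mono_of_dom {x y : ℕ → ℝ} (hx : ∃ C, ∀ n, |x n| ≤ C) (f : ℕ → ℕ)
    (h : ∀ k, y k = 0 ∨ ∃ j, f j = k ∧ |y k| ≤ |x j|) (n : ℕ) : decRearr y n ≤ decRearr x n := by
  classical
  obtain ⟨C, hC⟩ := hx
  refine le_decRearr fun F hF => ?_
  refine decRearr_le (F := F.image f) (Finset.card_image_le.trans hF)
    (Real.iSup_nonneg fun _ => abs_nonneg _) fun k hk => ?_
  rcases h k with h0 | ⟨j, rfl, hj⟩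
  · rw [h0, abs_zero]; exact Real.iSup_nonneg fun _ => abs_nonneg _
  · have hjF : j ∉ F := fun hj' => hk (Finset.mem_image_of_mem f hj')
    refine hj.trans (le_ciSup (f := fun k : {k : ℕ // k ∉ F} => |x k|) ⟨C, ?_⟩ ⟨j, hjF⟩)
    rintro _ ⟨i, rfl⟩
    exact hC i

end rearrangement

namespace SymmetricSequenceSpace

variable (E : SymmetricSequenceSpace)

theorem mem_and_norm_le_of_dom {x y : ℕ → ℝ} (hx : x ∈ E.carrier) (f : ℕ → ℕ)
    (h : ∀ k, y k = 0 ∨ ∃ j, f j = k ∧ |y k| ≤ |x j|) : y ∈ E.carrier ∧ E.norm y ≤ E.norm x := by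
  obtain ⟨C, hC⟩ := E.bounded_of_mem x hx
  refine E.symmetric x hx y ⟨C, fun k => ?_⟩ (decRearr_mono_of_dom ⟨C, hC⟩ f h)
  rcases h k with h0 | ⟨j, -, hj⟩
  · rw [h0, abs_zero]; exact (abs_nonneg _).trans (hC 0)
  · exact hj.trans (hC j)

theorem mem_and_norm_le {x y : ℕ → ℝ} (hx : x ∈ E.carrier) (h : ∀ k, |y k| ≤ |x k|) :
    y ∈ E.carrier ∧ E.norm y ≤ E.norm x :=
  E.mem_and_norm_le_of_dom hx id fun k => Or.inr ⟨k, rfl, h k⟩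

theorem norm_zero : E.norm 0 = 0 := by
  simpa using E.norm_smul 0 0 E.carrier.zero_mem

theorem norm_neg {x : ℕ → ℝ} (hx : x ∈ E.carrier) : E.norm (-x) = E.norm x := by
  simpa using E.norm_smul (-1) x hx

theorem norm_nonneg {x : ℕ → ℝ} (hx : x ∈ E.carrier) : 0 ≤ E.norm x := by
  rw [← E.norm_zero]
  exact (E.mem_and_norm_le hx fun k => by simp).2

theorem norm_sum_le {ι : Type*} (s : Finset ι) (u : ι → ℕ → ℝ) (hu : ∀ i ∈ s, u i ∈ E.carrier) :
    E.norm (∑ i ∈ s, u i) ≤ ∑ i ∈ s, E.norm (u i) := by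
  classical
  induction s using Finset.induction_on with
  | empty => simp [E.norm_zero]
  | insert a s ha ih =>
    rw [Finset.sum_insert ha, Finset.sum_insert ha]
    refine (E.norm_add_le _ (hu a (by simp)) _
      (Submodule.sum_mem _ fun i hi => hu i (by simp [hi]))).trans ?_
    gcongr
    exact ih fun i hi => hu i (by simp [hi])

theorem single_mem (k : ℕ) (c : ℝ) : (Pi.single k c : ℕ → ℝ) ∈ E.carrier :=
  E.mem_of_summable _ (summable_of_hasFiniteSupport
    ((finite_singleton k).subset fun j hj => by
      by_contra h
      exact hj (by simp [Pi.single_eq_of_ne (show j ≠ k from h)])))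

theorem norm_single_pos (k : ℕ) : 0 < E.norm (Pi.single k 1) := by
  refine lt_of_le_of_ne (E.norm_nonneg (E.single_mem k 1)) fun h => ?_
  have := congrFun (E.eq_zero_of_norm_eq_zero _ (E.single_mem k 1) h.symm) k
  simp at this

theorem abs_apply_mul_le {x : ℕ → ℝ} (hx : x ∈ E.carrier) (k : ℕ) :
    |x k| * E.norm (Pi.single k 1) ≤ E.norm x := by
  have h1 : x k • (Pi.single k 1 : ℕ → ℝ) = Pi.single k (x k) := by
    ext j; by_cases h : j = k
    · subst h; simp
    · simp [Pi.single_eq_of_ne h]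
  have := (E.mem_and_norm_le hx (y := x k • (Pi.single k 1 : ℕ → ℝ)) fun j => by
    rw [h1]; by_cases h : j = k
    · subst h; simp
    · simp [Pi.single_eq_of_ne h]).2
  rwa [E.norm_smul _ _ (E.single_mem k 1)] at this

/-- The underlying Banach space of a symmetric sequence space. -/
def Space : Type := ↥E.carrier

instance : AddCommGroup E.Space := inferInstanceAs (AddCommGroup ↥E.carrier)

instance : Module ℝ E.Space := inferInstanceAs (Module ℝ ↥E.carrier)

instance : Norm E.Space := ⟨fun x => E.norm x.1⟩

theorem core : NormedSpace.Core ℝ E.Space where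
  norm_nonneg x := E.norm_nonneg x.2
  norm_smul c x := E.norm_smul c x.1 x.2
  norm_triangle x y := E.norm_add_le x.1 x.2 y.1 y.2
  norm_eq_zero_iff x := ⟨fun h => Subtype.ext (E.eq_zero_of_norm_eq_zero x.1 x.2 h),
    fun h => by subst h; exact E.norm_zero⟩

instance : NormedAddCommGroup E.Space := NormedAddCommGroup.ofCore E.core

instance : NormedSpace ℝ E.Space := NormedSpace.ofCore E.core

/-- Elements of a separable symmetric sequence space have norm-null tails. -/
theorem exists_norm_tail_lt [TopologicalSpace.SeparableSpace E.Space] {x : ℕ → ℝ}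
    (hx : x ∈ E.carrier) {ε : ℝ} (hε : 0 < ε) :
    ∃ N, E.norm ((Ici N).indicator x) < ε := by
  classical
  have hind : ∀ s : Set ℕ, s.indicator x ∈ E.carrier := fun s =>
    (E.mem_and_norm_le hx fun k => by
      by_cases h : k ∈ s <;> simp [h]).1
  by_contra! hcon
  have hstep : ∃ δ > 0, ∀ N, ∃ m > N, δ ≤ E.norm ((Ico N m).indicator x) := by
    by_contra! hc
    obtain ⟨y, hy, hlim⟩ := E.complete (fun i => (Iio i).indicator x) (fun i => hind _) (by
      intro δ hδ
      obtain ⟨N, hN⟩ := hc (δ / 2) (by positivity)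
      have key : ∀ i ≥ N, E.norm ((Iio i).indicator x - (Iio N).indicator x) < δ / 2 := by
        intro i hi
        have he : (Iio i).indicator x - (Iio N).indicator x = (Ico N i).indicator x := by
          ext k
          simp only [Pi.sub_apply, indicator_apply, mem_Iio, mem_Ico]
          split_ifs <;> first | omega | simp
        rw [he]
        rcases hi.lt_or_eq with h | h
        · exact hN i h
        · subst h
          rw [Ico_self, indicator_empty]
          exact E.norm_zero.trans_lt (half_pos hδ)
      refine ⟨N, fun i hi j hj => ?_⟩
      have he : (Iio i).indicator x - (Iio j).indicator x =
          ((Iio i).indicator x - (Iio N).indicator x) +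
            -((Iio j).indicator x - (Iio N).indicator x) := by abel
      rw [he]
      have hm : ∀ i, (Iio i).indicator x - (Iio N).indicator x ∈ E.carrier := fun i =>
        E.carrier.sub_mem (hind _) (hind _)
      refine (E.norm_add_le _ (hm i) _ (E.carrier.neg_mem (hm j))).trans_lt ?_
      rw [E.norm_neg (hm j)]
      linarith [key i hi, key j hj])
    have hxy : y = x := by
      ext k
      by_contra hne
      have hpos : 0 < |x k - y k| * E.norm (Pi.single k 1) :=
        mul_pos (abs_pos.2 (sub_ne_zero.2 (Ne.symm hne))) (E.norm_single_pos k)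
      obtain ⟨N, hN⟩ := hlim _ hpos
      have h1 := hN (max N (k + 1)) (le_max_left _ _)
      have h2 := E.abs_apply_mul_le (E.carrier.sub_mem (hind (Iio (max N (k + 1)))) hy) k
      have h3 : ((Iio (max N (k + 1))).indicator x - y) k = x k - y k := by
        simp
      rw [h3] at h2
      linarith
    subst hxy
    obtain ⟨N, hN⟩ := hlim ε hε
    have h1 := hN N le_rfl
    have he : (Iio N).indicator y - y = -(Ici N).indicator y := by
      ext k
      simp only [Pi.sub_apply, Pi.neg_apply, indicator_apply, mem_Iio, mem_Ici]
      split_ifs <;> first | omega | simp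
    rw [he, E.norm_neg (hind _)] at h1
    linarith [hcon N]
  obtain ⟨δ, hδ, hstep⟩ := hstep
  choose m hm hmδ using hstep
  obtain ⟨n, hn⟩ : ∃ n : ℕ → ℕ, ∀ i, n (i + 1) = m (n i) :=
    ⟨fun i => Nat.rec 0 (fun _ a => m a) i, fun _ => rfl⟩
  have hmono : StrictMono n := strictMono_nat_of_lt_succ fun i => by rw [hn]; exact hm _
  have huniq : ∀ i j k, k ∈ Ico (n i) (n (i + 1)) → k ∈ Ico (n j) (n (j + 1)) → i = j := by
    intro i j k hi hj
    rcases lt_trichotomy i j with h | h | h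
    · have := hmono.monotone (show i + 1 ≤ j by omega)
      simp only [mem_Ico] at hi hj; omega
    · exact h
    · have := hmono.monotone (show j + 1 ≤ i by omega)
      simp only [mem_Ico] at hi hj; omega
  let B : Set ℕ → Set ℕ := fun A => {k | ∃ i ∈ A, k ∈ Ico (n i) (n (i + 1))}
  let X : Set ℕ → E.Space := fun A => (⟨(B A).indicator x, hind _⟩ : E.carrier)
  have hsep1 : ∀ A A' : Set ℕ, ∀ i, i ∈ A → i ∉ A' → δ ≤ dist (X A) (X A') := by
    intro A A' i hi hi'
    rw [dist_eq_norm]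
    refine (hmδ (n i)).trans (E.mem_and_norm_le (E.carrier.sub_mem (hind (B A)) (hind (B A')))
      fun k => ?_).2
    rw [← hn i]
    by_cases hk : k ∈ Ico (n i) (n (i + 1))
    · have h1 : k ∈ B A := ⟨i, hi, hk⟩
      have h2 : k ∉ B A' := fun ⟨j, hj, hkj⟩ => hi' (huniq i j k hk hkj ▸ hj)
      simp only [Pi.sub_apply, indicator_of_mem h1, indicator_of_notMem h2, sub_zero]
      exact le_of_eq (by rw [indicator_of_mem hk])
    · rw [indicator_of_notMem hk, abs_zero]; exact abs_nonneg _
  have hsep : ∀ A A' : Set ℕ, A ≠ A' → δ ≤ dist (X A) (X A') := by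
    intro A A' hne
    by_cases h : ∃ i, i ∈ A ∧ i ∉ A'
    · obtain ⟨i, h1, h2⟩ := h; exact hsep1 _ _ i h1 h2
    · push Not at h
      have : ∃ i, i ∈ A' ∧ i ∉ A := by
        by_contra! h'
        exact hne (Subset.antisymm h h')
      obtain ⟨i, h1, h2⟩ := this
      rw [dist_comm]; exact hsep1 _ _ i h1 h2
  have hcount : Countable (Set ℕ) := by
    refine Pairwise.countable_of_isOpen_disjoint (s := fun A => Metric.ball (X A) (δ / 2)) ?_
      (fun A => Metric.isOpen_ball) (fun A => ⟨X A, Metric.mem_ball_self (by positivity)⟩)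
    intro A A' hne
    exact Metric.ball_disjoint_ball (by linarith [hsep A A' hne])
  obtain ⟨g, hg⟩ := exists_surjective_nat (Set ℕ)
  exact Function.cantor_surjective g hg

end SymmetricSequenceSpace

section singular

variable {H : Type*} [NormedAddCommGroup H] [InnerProductSpace ℂ H]

theorem norm_comp_starProjection_le (x : H →L[ℂ] H) {K L : Submodule ℂ H}
    [K.HasOrthogonalProjection] [L.HasOrthogonalProjection] (h : K ≤ L) :
    ‖x ∘L K.starProjection‖ ≤ ‖x ∘L L.starProjection‖ := by
  refine ContinuousLinearMap.opNorm_le_bound _ (norm_nonneg _) fun v => ?_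
  have h1 : K.starProjection v ∈ L := h (K.starProjection_apply_mem v)
  have h2 : L.starProjection (K.starProjection v) = K.starProjection v :=
    Submodule.starProjection_eq_self_iff.2 h1
  calc ‖(x ∘L K.starProjection) v‖ = ‖(x ∘L L.starProjection) (K.starProjection v)‖ := by
        simp [h2]
    _ ≤ ‖x ∘L L.starProjection‖ * ‖K.starProjection v‖ := ContinuousLinearMap.le_opNorm _ _
    _ ≤ _ := by gcongr; exact Submodule.norm_starProjection_apply_le _ _

variable [CompleteSpace H]

/-- The singular values (generalized singular value function at the integers) of a bounded operator:
`singularValue x n` is the infimum of `‖x e‖` over the orthogonal projections `e` such that the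
projection `1 - e` has rank at most `n`. Here `e` is the projection onto `Kᗮ`, and `K` is the
range of `1 - e`. -/
def singularValue (x : H →L[ℂ] H) (n : ℕ) : ℝ :=
  ⨅ K : {K : Submodule ℂ H // FiniteDimensional ℂ K ∧ Module.finrank ℂ K ≤ n},
    ‖x ∘L (K.1ᗮ).starProjection‖

theorem singularValue_le (x : H →L[ℂ] H) {n : ℕ} (K : Submodule ℂ H) (hK : FiniteDimensional ℂ K)
    (hn : Module.finrank ℂ K ≤ n) : singularValue x n ≤ ‖x ∘L (Kᗮ).starProjection‖ := by
  refine ciInf_le (f := fun K : {K : Submodule ℂ H // FiniteDimensional ℂ K ∧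
    Module.finrank ℂ K ≤ n} => ‖x ∘L (K.1ᗮ).starProjection‖) ⟨0, ?_⟩ ⟨K, hK, hn⟩
  rintro _ ⟨L, rfl⟩
  exact norm_nonneg _

theorem le_singularValue {x : H →L[ℂ] H} {n : ℕ} {s : ℝ}
    (h : ∀ K : Submodule ℂ H, FiniteDimensional ℂ K → Module.finrank ℂ K ≤ n →
      s ≤ ‖x ∘L (Kᗮ).starProjection‖) : s ≤ singularValue x n := by
  have : Nonempty {K : Submodule ℂ H // FiniteDimensional ℂ K ∧ Module.finrank ℂ K ≤ n} :=
    ⟨⟨⊥, inferInstance, by simp⟩⟩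
  exact le_ciInf fun K => h K.1 K.2.1 K.2.2

theorem exists_lt_of_singularValue_lt {x : H →L[ℂ] H} {n : ℕ} {s : ℝ} (h : singularValue x n < s) :
    ∃ K : Submodule ℂ H, FiniteDimensional ℂ K ∧ Module.finrank ℂ K ≤ n ∧
      ‖x ∘L (Kᗮ).starProjection‖ < s := by
  by_contra! hc
  exact absurd (le_singularValue fun K h1 h2 => hc K h1 h2) (not_le.2 h)

theorem singularValue_nonneg (x : H →L[ℂ] H) (n : ℕ) : 0 ≤ singularValue x n :=
  le_singularValue fun _ _ _ => norm_nonneg _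

theorem singularValue_zero_index (x : H →L[ℂ] H) : singularValue x 0 = ‖x‖ := by
  have h0 : x ∘L ((⊥ : Submodule ℂ H)ᗮ).starProjection = x := by
    ext v
    rw [ContinuousLinearMap.comp_apply, Submodule.starProjection_eq_self_iff.2 (by simp)]
  refine le_antisymm ?_ (le_singularValue fun K hK h => ?_)
  · exact (singularValue_le x ⊥ inferInstance (by simp)).trans_eq (by rw [h0])
  · have : K = ⊥ := Submodule.finrank_eq_zero.1 (Nat.le_zero.1 h)
    subst this
    exact le_of_eq (by rw [h0])

theorem singularValue_antitone (x : H →L[ℂ] H) : Antitone (singularValue x) := fun _ _ hmn =>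
  le_singularValue fun K hK h => singularValue_le x K hK (h.trans hmn)

theorem singularValue_smul_le (c : ℂ) (x : H →L[ℂ] H) (n : ℕ) :
    singularValue (c • x) n ≤ ‖c‖ * singularValue x n := by
  rcases eq_or_ne c 0 with rfl | hc
  · refine (singularValue_le _ ⊥ inferInstance (by simp)).trans ?_
    simp
  · rw [← div_le_iff₀' (norm_pos_iff.2 hc)]
    refine le_singularValue fun K hK h => ?_
    rw [div_le_iff₀' (norm_pos_iff.2 hc)]
    refine (singularValue_le _ K hK h).trans_eq ?_
    rw [ContinuousLinearMap.smul_comp, norm_smul]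

theorem singularValue_smul (c : ℂ) (x : H →L[ℂ] H) (n : ℕ) :
    singularValue (c • x) n = ‖c‖ * singularValue x n := by
  refine le_antisymm (singularValue_smul_le c x n) ?_
  rcases eq_or_ne c 0 with rfl | hc
  · simpa using singularValue_nonneg _ n
  · have := singularValue_smul_le c⁻¹ (c • x) n
    rw [inv_smul_smul₀ hc, norm_inv] at this
    rwa [← le_inv_mul_iff₀ (norm_pos_iff.2 hc)]

theorem singularValue_add_le (x y : H →L[ℂ] H) (m n : ℕ) :
    singularValue (x + y) (m + n) ≤ singularValue x m + singularValue y n := by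
  refine le_of_forall_pos_le_add fun ε hε => ?_
  obtain ⟨K, hK, hKm, hKx⟩ := exists_lt_of_singularValue_lt
    (lt_add_of_pos_right (singularValue x m) (half_pos hε))
  obtain ⟨L, hL, hLn, hLy⟩ := exists_lt_of_singularValue_lt
    (lt_add_of_pos_right (singularValue y n) (half_pos hε))
  refine (singularValue_le (x + y) (K ⊔ L) inferInstance
    ((Submodule.finrank_add_le_finrank_add_finrank K L).trans (by omega))).trans ?_
  rw [ContinuousLinearMap.add_comp]
  refine (norm_add_le _ _).trans ?_
  have h1 := norm_comp_starProjection_le x (Submodule.orthogonal_le (le_sup_left : K ≤ K ⊔ L))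
  have h2 := norm_comp_starProjection_le y (Submodule.orthogonal_le (le_sup_right : L ≤ K ⊔ L))
  linarith

end singular

/-- The Schatten space `S_E(H)`: bounded operators on `H` whose sequence of singular values
belongs to `E`. -/
def schatten (E : SymmetricSequenceSpace) (H : Type*) [NormedAddCommGroup H]
    [InnerProductSpace ℂ H] [CompleteSpace H] : Submodule ℂ (H →L[ℂ] H) where
  carrier := {x | singularValue x ∈ E.carrier}
  zero_mem' := by
    have : singularValue (0 : H →L[ℂ] H) = 0 := by
      ext n
      simpa using singularValue_smul (0 : ℂ) (0 : H →L[ℂ] H) n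
    simpa only [mem_ofPred_eq, this] using E.carrier.zero_mem
  smul_mem' c x hx := by
    have : singularValue (c • x) = ‖c‖ • singularValue x := by
      ext n
      simpa using singularValue_smul c x n
    simpa only [mem_ofPred_eq, this] using E.carrier.smul_mem _ hx
  add_mem' {x y} hx hy := by
    have key : ∀ z : H →L[ℂ] H, singularValue z ∈ E.carrier →
        (fun k => singularValue z (k / 2)) ∈ E.carrier := by
      intro z hz
      have h1 := (E.mem_and_norm_le_of_dom hz (fun j => 2 * j)
        (y := fun k => if k % 2 = 0 then singularValue z (k / 2) else 0) fun k => by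
          by_cases h : k % 2 = 0
          · exact Or.inr ⟨k / 2, by omega, by simp [h]⟩
          · exact Or.inl (by simp [h])).1
      have h2 := (E.mem_and_norm_le_of_dom hz (fun j => 2 * j + 1)
        (y := fun k => if k % 2 = 0 then 0 else singularValue z (k / 2)) fun k => by
          by_cases h : k % 2 = 0
          · exact Or.inl (by simp [h])
          · exact Or.inr ⟨k / 2, by omega, by simp [h]⟩).1
      convert E.carrier.add_mem h1 h2 using 1
      ext k
      by_cases h : k % 2 = 0 <;> simp [h]
    refine (E.mem_and_norm_le (E.carrier.add_mem (key x hx) (key y hy)) fun k => ?_).1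
    rw [abs_of_nonneg (singularValue_nonneg _ _)]
    refine le_trans ?_ (le_abs_self _)
    exact (singularValue_antitone _ (by omega : k / 2 + k / 2 ≤ k)).trans
      (singularValue_add_le x y _ _)


section majorization

open Matrix

/-- Extension of a finite sequence by zeros. -/
def padZero {n : ℕ} (v : Fin n → ℝ) (k : ℕ) : ℝ := if h : k < n then v ⟨k, h⟩ else 0

theorem padZero_fin {n : ℕ} (v : Fin n → ℝ) (i : Fin n) : padZero v i = v i := by
  simp [padZero]

theorem padZero_of_le {n : ℕ} (v : Fin n → ℝ) {k : ℕ} (h : n ≤ k) : padZero v k = 0 := by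
  simp [padZero, not_lt.2 h]

theorem padZero_bounded {n : ℕ} (v : Fin n → ℝ) : ∃ C, ∀ k, |padZero v k| ≤ C := by
  refine ⟨∑ i, |v i|, fun k => ?_⟩
  rcases lt_or_ge k n with h | h
  · have := padZero_fin v ⟨k, h⟩
    simp only at this
    rw [this]
    exact Finset.single_le_sum (f := fun i => |v i|) (fun _ _ => abs_nonneg _) (Finset.mem_univ _)
  · rw [padZero_of_le v h, abs_zero]
    exact Finset.sum_nonneg fun _ _ => abs_nonneg _

theorem padZero_mem (E : SymmetricSequenceSpace) {n : ℕ} (v : Fin n → ℝ) :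
    padZero v ∈ E.carrier := by
  refine E.mem_of_summable _ (summable_of_hasFiniteSupport ((finite_Iio n).subset fun k hk => ?_))
  by_contra h
  exact hk (by simp only [padZero_of_le v (not_lt.1 h), abs_zero])

theorem norm_padZero_mulVec_le (E : SymmetricSequenceSpace) {n : ℕ} (v : Fin n → ℝ)
    {D : Matrix (Fin n) (Fin n) ℝ} (hD : D ∈ doublyStochastic ℝ (Fin n)) :
    E.norm (padZero (D *ᵥ v)) ≤ E.norm (padZero v) := by
  let S : Set (Matrix (Fin n) (Fin n) ℝ) := {D | E.norm (padZero (D *ᵥ v)) ≤ E.norm (padZero v)}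
  have hS : Convex ℝ S := by
    intro A hA B hB a b ha hb hab
    have he : padZero ((a • A + b • B) *ᵥ v) = a • padZero (A *ᵥ v) + b • padZero (B *ᵥ v) := by
      ext k
      rcases lt_or_ge k n with h | h
      · simp [padZero, h, Matrix.add_mulVec, Matrix.smul_mulVec]
      · simp [padZero_of_le _ h]
    change E.norm _ ≤ _
    rw [he]
    refine (E.norm_add_le _ (E.carrier.smul_mem _ (padZero_mem E _)) _
      (E.carrier.smul_mem _ (padZero_mem E _))).trans ?_
    rw [E.norm_smul _ _ (padZero_mem E _), E.norm_smul _ _ (padZero_mem E _), abs_of_nonneg ha,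
      abs_of_nonneg hb]
    calc _ ≤ a * E.norm (padZero v) + b * E.norm (padZero v) := by
          gcongr
          · exact hA
          · exact hB
      _ = _ := by rw [← add_mul, hab, one_mul]
  have hsub : (doublyStochastic ℝ (Fin n) : Set (Matrix (Fin n) (Fin n) ℝ)) ⊆ S := by
    rw [doublyStochastic_eq_convexHull_permMatrix]
    refine convexHull_min ?_ hS
    rintro _ ⟨σ, rfl⟩
    refine (E.mem_and_norm_le_of_dom (padZero_mem E v)
      (fun j => if h : j < n then (σ.symm ⟨j, h⟩ : Fin n) else j) fun k => ?_).2
    rcases lt_or_ge k n with h | h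
    · refine Or.inr ⟨σ ⟨k, h⟩, by simp, le_of_eq ?_⟩
      rw [padZero_fin]
      simp [padZero, h, Matrix.permMatrix_mulVec]
    · exact Or.inl (padZero_of_le _ h)
  exact hsub hD

end majorization

section compression

variable {H : Type*} [NormedAddCommGroup H] [InnerProductSpace ℂ H]

/-- The compression of an operator to a finite-dimensional subspace. -/
def compression (x : H →L[ℂ] H) (K : Submodule ℂ H) [FiniteDimensional ℂ K] : K →ₗ[ℂ] K where
  toFun u := ⟨K.starProjection (x u), K.starProjection_apply_mem _⟩
  map_add' u v := by ext; simp
  map_smul' c u := by ext; simp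

theorem inner_compression (x : H →L[ℂ] H) (K : Submodule ℂ H) [FiniteDimensional ℂ K] (u v : K) :
    inner ℂ (compression x K u) v = inner ℂ (x u) (v : H) := by
  change inner ℂ (K.starProjection (x u)) (v : H) = _
  rw [Submodule.inner_starProjection_left_eq_right, Submodule.starProjection_eq_self_iff.2 v.2]

variable [CompleteSpace H]

theorem compression_isSymmetric {x : H →L[ℂ] H} (hx : IsSelfAdjoint x) (K : Submodule ℂ H)
    [FiniteDimensional ℂ K] : (compression x K).IsSymmetric := by
  intro u v
  rw [inner_compression, ← inner_conj_symm u, inner_compression, inner_conj_symm]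
  exact hx.isSymmetric _ _

variable {x : H →L[ℂ] H} (hx : IsSelfAdjoint x) (K : Submodule ℂ H) [FiniteDimensional ℂ K]

/-- Eigenvalues of the compression. -/
def cEig (i : Fin (Module.finrank ℂ K)) : ℝ := (compression_isSymmetric hx K).eigenvalues rfl i

/-- An orthonormal eigenbasis of the compression. -/
def cBasis : OrthonormalBasis (Fin (Module.finrank ℂ K)) ℂ K :=
  (compression_isSymmetric hx K).eigenvectorBasis rfl

theorem cBasis_repr (v : K) (i : Fin (Module.finrank ℂ K)) :
    (cBasis hx K).repr (compression x K v) i = cEig hx K i * (cBasis hx K).repr v i :=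
  (compression_isSymmetric hx K).eigenvectorBasis_apply_self_apply rfl v i

theorem norm_sq_eq_repr (v : K) : ‖v‖ ^ 2 = ∑ i, ‖(cBasis hx K).repr v i‖ ^ 2 := by
  rw [← (cBasis hx K).repr.norm_map v, EuclideanSpace.norm_sq_eq]

theorem norm_sq_compression (v : K) :
    ‖compression x K v‖ ^ 2 = ∑ i, cEig hx K i ^ 2 * ‖(cBasis hx K).repr v i‖ ^ 2 := by
  rw [norm_sq_eq_repr hx]
  refine Finset.sum_congr rfl fun i _ => ?_
  rw [cBasis_repr, norm_mul, mul_pow, Complex.norm_real, Real.norm_eq_abs, sq_abs]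

theorem decRearr_cEig_le (k : ℕ) : decRearr (padZero (cEig hx K)) k ≤ singularValue x k := by
  classical
  refine le_singularValue fun L hL hLk => ?_
  set s := decRearr (padZero (cEig hx K)) k with hs
  rcases (decRearr_nonneg (padZero (cEig hx K)) k).eq_or_lt with h0 | hpos
  · rw [hs, ← h0]; exact norm_nonneg _
  rw [← hs] at hpos
  let G : Finset (Fin (Module.finrank ℂ K)) := Finset.univ.filter fun i => s ≤ |cEig hx K i|
  have hG : k < G.card := by
    by_contra! hcon
    let F : Finset ℕ := G.image fun i : Fin (Module.finrank ℂ K) => (i : ℕ)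
    have hFk : F.card ≤ k :=
      (Finset.card_image_le (s := G) (f := fun i : Fin (Module.finrank ℂ K) => (i : ℕ))).trans hcon
    -- strictly smaller bound off `F`
    obtain ⟨t, ht0, hts, ht⟩ : ∃ t, 0 ≤ t ∧ t < s ∧ ∀ i ∉ G, |cEig hx K i| ≤ t := by
      rcases (Gᶜ).eq_empty_or_nonempty with he | hne
      · refine ⟨0, le_rfl, hpos, fun i hi => ?_⟩
        rw [← Finset.mem_compl, he] at hi
        simp at hi
      · obtain ⟨i0, hi0, hmax⟩ := Finset.exists_max_image Gᶜ (fun i => |cEig hx K i|) hne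
        refine ⟨|cEig hx K i0|, abs_nonneg _, ?_, fun i hi => hmax i (Finset.mem_compl.2 hi)⟩
        simpa [G] using hi0
    refine absurd (decRearr_le (x := padZero (cEig hx K)) (F := F)
      hFk ht0 fun j hj => ?_) (not_le.2 hts)
    rcases lt_or_ge j (Module.finrank ℂ K) with h | h
    · have := padZero_fin (cEig hx K) ⟨j, h⟩
      simp only at this
      rw [this]
      exact ht _ fun hm => hj (Finset.mem_image.2 ⟨_, hm, rfl⟩)
    · rw [padZero_of_le _ h, abs_zero]; exact ht0
  -- a vector of the span of the eigenvectors indexed by `G` that is orthogonal to `L`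
  let Φ : (G → ℂ) →ₗ[ℂ] K :=
    { toFun := fun c => ∑ i, c i • (cBasis hx K) i
      map_add' := fun c d => by simp [add_smul, Finset.sum_add_distrib]
      map_smul' := fun a c => by simp [Finset.smul_sum, mul_smul] }
  have hrepr : ∀ c i, (cBasis hx K).repr (Φ c) i = if h : i ∈ G then c ⟨i, h⟩ else 0 := by
    intro c i
    change (cBasis hx K).repr (∑ j, c j • (cBasis hx K) j) i = _
    rw [OrthonormalBasis.repr_apply_apply, inner_sum]
    simp only [inner_smul_right, OrthonormalBasis.inner_eq_ite]
    by_cases h : i ∈ G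
    · rw [dif_pos h, Finset.sum_eq_single ⟨i, h⟩]
      · simp
      · intro j _ hj
        rw [if_neg fun he => hj (Subtype.ext he.symm), mul_zero]
      · simp
    · rw [dif_neg h]
      refine Finset.sum_eq_zero fun j _ => ?_
      rw [if_neg (show ¬ i = (j : Fin _) from fun he => h (he ▸ j.2)), mul_zero]
  let Ψ : (G → ℂ) →ₗ[ℂ] L :=
    { toFun := fun c => ⟨L.starProjection (Φ c : H), L.starProjection_apply_mem _⟩
      map_add' := fun c d => by ext; simp
      map_smul' := fun a c => by ext; simp }
  have hker : LinearMap.ker Ψ ≠ ⊥ := by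
    refine LinearMap.ker_ne_bot_of_finrank_lt ?_
    rw [Module.finrank_fintype_fun_eq_card, Fintype.card_coe]
    omega
  obtain ⟨c, hc, hc0⟩ := Submodule.exists_mem_ne_zero_of_ne_bot hker
  set v : K := Φ c with hv
  have hvL : (v : H) ∈ Lᗮ := by
    have h1 : L.starProjection (v : H) = 0 := congrArg Subtype.val (LinearMap.mem_ker.1 hc)
    exact (Submodule.starProjection_apply_eq_zero_iff L).1 h1
  have hv0 : v ≠ 0 := by
    intro h
    refine hc0 (funext fun i => ?_)
    have := hrepr c i
    rw [← hv, h, dif_pos i.2] at this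
    simpa using this.symm
  have hle : s * ‖v‖ ≤ ‖compression x K v‖ := by
    refine le_of_sq_le_sq ?_ (norm_nonneg _)
    rw [mul_pow, norm_sq_compression hx, norm_sq_eq_repr hx, Finset.mul_sum]
    refine Finset.sum_le_sum fun i _ => ?_
    by_cases h : i ∈ G
    · have h1 : s ≤ |cEig hx K i| := by simpa [G] using h
      have h2 : s ^ 2 ≤ cEig hx K i ^ 2 := by
        rw [← sq_abs (cEig hx K i)]; gcongr
      gcongr
    · rw [hv, hrepr, dif_neg h]; simp
  have hvpos : 0 < ‖v‖ := norm_pos_iff.2 hv0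
  refine le_of_mul_le_mul_right (hle.trans ?_) hvpos
  calc ‖compression x K v‖ = ‖K.starProjection (x v)‖ := rfl
    _ ≤ ‖x v‖ := Submodule.norm_starProjection_apply_le _ _
    _ = ‖(x ∘L Lᗮ.starProjection) v‖ := by
        rw [ContinuousLinearMap.comp_apply, Submodule.starProjection_eq_self_iff.2 hvL]
    _ ≤ _ := ContinuousLinearMap.le_opNorm _ _

theorem singularValue_le_cEig {δ : ℝ} (hδ : ‖x ∘L Kᗮ.starProjection‖ ≤ δ) (k : ℕ) :
    singularValue x k ≤ decRearr (padZero (cEig hx K)) k + 2 * δ := by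
  classical
  rw [← sub_le_iff_le_add]
  refine le_decRearr fun F hF => ?_
  rw [sub_le_iff_le_add]
  obtain ⟨C, hC⟩ := padZero_bounded (cEig hx K)
  set s := ⨆ k : {k : ℕ // k ∉ F}, |padZero (cEig hx K) k| with hs
  have hs0 : 0 ≤ s := Real.iSup_nonneg fun _ => abs_nonneg _
  have hsF : ∀ i : Fin (Module.finrank ℂ K), (i : ℕ) ∉ F → |cEig hx K i| ≤ s := by
    intro i hi
    rw [← padZero_fin (cEig hx K) i]
    refine le_ciSup (f := fun k : {k : ℕ // k ∉ F} => |padZero (cEig hx K) k|) ⟨C, ?_⟩ ⟨i, hi⟩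
    rintro _ ⟨j, rfl⟩
    exact hC j
  let F' : Finset (Fin (Module.finrank ℂ K)) := Finset.univ.filter fun i => (i : ℕ) ∈ F
  have hF' : F'.card ≤ k := by
    refine le_trans ?_ hF
    refine Finset.card_le_card_of_injOn (fun i => (i : ℕ)) (fun i hi => ?_)
      (fun i _ j _ h => Fin.ext h)
    simpa [F'] using hi
  let L : Submodule ℂ H := Submodule.span ℂ (F'.image fun i => ((cBasis hx K i : K) : H))
  have hL : FiniteDimensional ℂ L := FiniteDimensional.span_finset ℂ _
  have hLk : Module.finrank ℂ L ≤ k :=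
    (finrank_span_finset_le_card _).trans (Finset.card_image_le.trans hF')
  have hadj : ∀ w, ‖Kᗮ.starProjection (x w)‖ ≤ δ * ‖w‖ := by
    have h1 : ContinuousLinearMap.adjoint (x ∘L Kᗮ.starProjection) = Kᗮ.starProjection ∘L x := by
      rw [ContinuousLinearMap.adjoint_comp]
      congr 1
      · exact (isSelfAdjoint_starProjection Kᗮ).adjoint_eq
    intro w
    rw [← ContinuousLinearMap.comp_apply, ← h1]
    refine (ContinuousLinearMap.le_opNorm _ _).trans ?_
    rw [LinearIsometryEquiv.norm_map]
    gcongr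
  refine (singularValue_le x L hL hLk).trans ?_
  have hδ0 : 0 ≤ δ := (norm_nonneg _).trans hδ
  refine ContinuousLinearMap.opNorm_le_bound _ (by positivity) fun w => ?_
  set v := Lᗮ.starProjection w with hv
  have hvw : ‖v‖ ≤ ‖w‖ := Submodule.norm_starProjection_apply_le _ _
  have hvL : v ∈ Lᗮ := Lᗮ.starProjection_apply_mem w
  let u : K := ⟨K.starProjection v, K.starProjection_apply_mem v⟩
  have hdec : v = u + Kᗮ.starProjection v := by
    change v = K.starProjection v + _
    rw [Submodule.starProjection_add_starProjection_orthogonal]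
  have hu : ‖u‖ ≤ ‖v‖ := Submodule.norm_starProjection_apply_le _ _
  have hzero : ∀ i ∈ F', (cBasis hx K).repr u i = 0 := by
    intro i hi
    rw [OrthonormalBasis.repr_apply_apply]
    change inner ℂ ((cBasis hx K i : K) : H) (K.starProjection v) = 0
    rw [← Submodule.inner_starProjection_left_eq_right,
      Submodule.starProjection_eq_self_iff.2 (cBasis hx K i).2]
    exact hvL _ (Submodule.subset_span (by simpa using ⟨i, hi, rfl⟩))
  have hcomp : ‖compression x K u‖ ≤ s * ‖u‖ := by
    refine le_of_sq_le_sq ?_ (by positivity)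
    rw [mul_pow, norm_sq_compression hx, norm_sq_eq_repr hx, Finset.mul_sum]
    refine Finset.sum_le_sum fun i _ => ?_
    by_cases h : i ∈ F'
    · rw [hzero i h]; simp
    · have h1 : |cEig hx K i| ≤ s := hsF i (by simpa [F'] using h)
      have h2 : cEig hx K i ^ 2 ≤ s ^ 2 := by
        rw [← sq_abs (cEig hx K i)]; gcongr
      gcongr
  have hxu : x u = (compression x K u : K) + Kᗮ.starProjection (x u) := by
    change x u = K.starProjection (x u) + _
    rw [Submodule.starProjection_add_starProjection_orthogonal]
  calc ‖(x ∘L Lᗮ.starProjection) w‖ = ‖x v‖ := rfl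
    _ = ‖x u + (x ∘L Kᗮ.starProjection) v‖ := by
        conv_lhs => rw [hdec, map_add]
        rfl
    _ ≤ ‖x u‖ + ‖(x ∘L Kᗮ.starProjection) v‖ := norm_add_le _ _
    _ ≤ (s * ‖v‖ + δ * ‖v‖) + δ * ‖v‖ := by
        gcongr
        · rw [hxu]
          refine (norm_add_le _ _).trans ?_
          gcongr
          · exact hcomp.trans (by gcongr)
          · exact (hadj u).trans (by gcongr; exact hu)
        · exact (ContinuousLinearMap.le_opNorm _ _).trans (by gcongr)
    _ = (s + 2 * δ) * ‖v‖ := by ring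
    _ ≤ (s + 2 * δ) * ‖w‖ := by gcongr

theorem decRearr_le_of_antitone {u : ℕ → ℝ} (h0 : ∀ k, 0 ≤ u k) (hu : Antitone u) (n : ℕ) :
    decRearr u n ≤ u n :=
  decRearr_le (F := Finset.range n) (by simp) (h0 n) fun k hk => by
    rw [abs_of_nonneg (h0 k)]
    exact hu (by simpa using hk)

theorem le_decRearr_of_antitone {u : ℕ → ℝ} (h0 : ∀ k, 0 ≤ u k) (hu : Antitone u) (n : ℕ) :
    u n ≤ decRearr u n := by
  refine le_decRearr fun F hF => ?_
  obtain ⟨k, hk, hkF⟩ : ∃ k ∈ Finset.range (n + 1), k ∉ F :=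
    Finset.exists_mem_notMem_of_card_lt_card (by simpa using Nat.lt_succ_of_le hF)
  refine (hu (by simpa [Nat.lt_succ_iff] using hk)).trans ?_
  rw [← abs_of_nonneg (h0 k)]
  refine le_ciSup (f := fun k : {k : ℕ // k ∉ F} => |u k|) ⟨u 0, ?_⟩ ⟨k, hkF⟩
  rintro _ ⟨j, rfl⟩
  simpa only [abs_of_nonneg (h0 _)] using hu (Nat.zero_le _)

theorem decRearr_antitone (u : ℕ → ℝ) : Antitone (decRearr u) := fun m n hmn =>
  le_decRearr fun F hF => by
    refine ciInf_le_of_le ⟨0, ?_⟩ ⟨F, hF.trans hmn⟩ le_rfl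
    rintro _ ⟨G, rfl⟩
    exact Real.iSup_nonneg fun _ => abs_nonneg _

/-- The norm of the diagonal of a self-adjoint operator in a finite orthonormal basis of a subspace
is at most the norm of its singular values. -/
theorem norm_padZero_diag_le (hx : IsSelfAdjoint x) (E : SymmetricSequenceSpace) (hxE : singularValue x ∈ E.carrier)
    (e : OrthonormalBasis (Fin (Module.finrank ℂ K)) ℂ K) :
    E.norm (padZero fun i => (inner ℂ (x (e i)) (e i : H)).re) ≤ E.norm (singularValue x) := by
  classical
  let D : Matrix (Fin (Module.finrank ℂ K)) (Fin (Module.finrank ℂ K)) ℝ :=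
    fun i j => ‖(inner ℂ (cBasis hx K j) (e i) : ℂ)‖ ^ 2
  have hD : D ∈ doublyStochastic ℝ (Fin (Module.finrank ℂ K)) := by
    rw [mem_doublyStochastic_iff_sum]
    refine ⟨fun i j => by positivity, fun i => ?_, fun j => ?_⟩
    · simp only [D]
      rw [OrthonormalBasis.sum_sq_norm_inner_right]
      simp
    · simp only [D]
      rw [OrthonormalBasis.sum_sq_norm_inner_left]
      simp
  have hdiag : (fun i => (inner ℂ (x (e i)) (e i : H)).re) = D.mulVec (cEig hx K) := by
    ext i
    rw [← inner_compression, ← (cBasis hx K).sum_inner_mul_inner, Complex.re_sum]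
    refine Finset.sum_congr rfl fun j _ => ?_
    have h1 : inner ℂ (cBasis hx K j) (compression x K (e i)) =
        cEig hx K j * inner ℂ (cBasis hx K j) (e i) := by
      rw [← OrthonormalBasis.repr_apply_apply, cBasis_repr, OrthonormalBasis.repr_apply_apply]
    rw [← inner_conj_symm, h1, map_mul, Complex.conj_ofReal, mul_assoc, Complex.conj_mul']
    simp only [D]
    norm_cast
    ring
  rw [hdiag]
  refine (norm_padZero_mulVec_le E _ hD).trans ?_
  exact (E.symmetric _ hxE _ (padZero_bounded _) fun k => (decRearr_cEig_le hx K k).trans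
    (le_decRearr_of_antitone (singularValue_nonneg x) (singularValue_antitone x) k)).2

theorem exists_singularValue_lt (E : SymmetricSequenceSpace)
    [TopologicalSpace.SeparableSpace E.Space] (hxE : singularValue x ∈ E.carrier) {δ : ℝ}
    (hδ : 0 < δ) : ∃ m, singularValue x m < δ := by
  obtain ⟨M, hM⟩ := E.exists_norm_tail_lt hxE (mul_pos hδ (E.norm_single_pos 0))
  refine ⟨M, ?_⟩
  have hmem : (Ici M).indicator (singularValue x) ∈ E.carrier :=
    (E.mem_and_norm_le hxE fun k => by by_cases h : k ∈ Ici M <;> simp [h]).1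
  have h1 := E.abs_apply_mul_le hmem M
  rw [indicator_of_mem (show M ∈ Ici M from mem_Ici.2 le_rfl), abs_of_nonneg (singularValue_nonneg x M)] at h1
  have h2 : E.norm (Pi.single 0 1) ≤ E.norm (Pi.single M 1) :=
    (E.mem_and_norm_le_of_dom (E.single_mem M 1) (fun _ => 0) fun k => by
      by_cases h : k = 0
      · subst h; exact Or.inr ⟨M, rfl, by simp⟩
      · exact Or.inl (Pi.single_eq_of_ne h 1)).2
  have h3 := mul_le_mul_of_nonneg_left h2 (singularValue_nonneg x M)
  exact lt_of_mul_lt_mul_right (h3.trans_lt (h1.trans_lt hM)) (E.norm_single_pos 0).le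

/-- The triangle inequality for self-adjoint elements of the Schatten space. -/
theorem norm_singularValue_add_le (E : SymmetricSequenceSpace)
    [TopologicalSpace.SeparableSpace E.Space] {x y : H →L[ℂ] H} (hx : IsSelfAdjoint x)
    (hy : IsSelfAdjoint y) (hxE : x ∈ schatten E H) (hyE : y ∈ schatten E H) :
    E.norm (singularValue (x + y)) ≤ E.norm (singularValue x) + E.norm (singularValue y) := by
  classical
  refine le_of_forall_pos_le_add fun ε hε => ?_
  have hz : IsSelfAdjoint (x + y) := hx.add hy
  have hzE : singularValue (x + y) ∈ E.carrier := (schatten E H).add_mem hxE hyE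
  obtain ⟨N, hN⟩ := E.exists_norm_tail_lt hzE (half_pos hε)
  set C := ∑ k ∈ Finset.range N, E.norm (Pi.single k 1) with hC
  have hC0 : 0 ≤ C := Finset.sum_nonneg fun k _ => (E.norm_single_pos k).le
  set δ := ε / (4 * (C + 1)) with hδ
  have hδ0 : 0 < δ := by positivity
  have hδC : 2 * δ * C ≤ ε / 2 := by
    have : δ * (C + 1) = ε / 4 := by rw [hδ]; field_simp
    nlinarith
  obtain ⟨m, hm⟩ := exists_singularValue_lt E hzE hδ0
  obtain ⟨K, hK, -, hKδ⟩ := exists_lt_of_singularValue_lt hm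
  set v := padZero (cEig hz K) with hv
  have hvE : v ∈ E.carrier := padZero_mem E _
  obtain ⟨hdE, hdn⟩ := E.symmetric v hvE (decRearr v) ⟨decRearr v 0, fun k => by
      rw [abs_of_nonneg (decRearr_nonneg v k)]; exact decRearr_antitone v (Nat.zero_le k)⟩
    (decRearr_le_of_antitone (decRearr_nonneg v) (decRearr_antitone v))
  have hvn : E.norm v ≤ E.norm (singularValue x) + E.norm (singularValue y) := by
    let e := cBasis hz K
    have hsplit : v = (padZero fun i => (inner ℂ (x (e i)) (e i : H)).re) +
        (padZero fun i => (inner ℂ (y (e i)) (e i : H)).re) := by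
      ext k
      rcases lt_or_ge k (Module.finrank ℂ K) with h | h
      · simp only [hv, padZero, h, dif_pos, Pi.add_apply]
        rw [← Complex.add_re, ← inner_add_left]
        have h1 : inner ℂ ((x + y) (e ⟨k, h⟩ : H)) (e ⟨k, h⟩ : H) = (cEig hz K ⟨k, h⟩ : ℂ) := by
          rw [← inner_compression, ← inner_conj_symm, ← OrthonormalBasis.repr_apply_apply,
            cBasis_repr, OrthonormalBasis.repr_apply_apply]
          have h2 : inner ℂ (cBasis hz K ⟨k, h⟩) (e ⟨k, h⟩) = (1 : ℂ) := by
            simp [e]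
          rw [h2]
          simp
        have h3 : x (e ⟨k, h⟩ : H) + y (e ⟨k, h⟩ : H) = (x + y) (e ⟨k, h⟩ : H) := rfl
        rw [h3, h1, Complex.ofReal_re]
      · simp [hv, padZero_of_le _ h]
    rw [hsplit]
    refine (E.norm_add_le _ (padZero_mem E _) _ (padZero_mem E _)).trans ?_
    gcongr
    · exact norm_padZero_diag_le K hx E hxE e
    · exact norm_padZero_diag_le K hy E hyE e
  set w : ℕ → ℝ := ∑ k ∈ Finset.range N, Pi.single k 1 with hw
  have hwE : w ∈ E.carrier := Submodule.sum_mem _ fun k _ => E.single_mem k 1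
  have hwn : E.norm w ≤ C := E.norm_sum_le _ _ fun k _ => E.single_mem k 1
  have hw1 : ∀ k < N, w k = 1 := fun k hk => by
    simp [hw, Finset.sum_apply, Pi.single_apply, hk]
  have hsumE : decRearr v + (2 * δ) • w ∈ E.carrier :=
    E.carrier.add_mem hdE (E.carrier.smul_mem _ hwE)
  obtain ⟨hhE, hhn⟩ := E.mem_and_norm_le (y := (Iio N).indicator (singularValue (x + y))) hsumE
    fun k => by
      by_cases h : k ∈ Iio N
      · rw [indicator_of_mem h, abs_of_nonneg (singularValue_nonneg _ _)]
        refine le_trans ?_ (le_abs_self _)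
        simpa [hw1 k h] using singularValue_le_cEig hz K hKδ.le k
      · rw [indicator_of_notMem h, abs_zero]; exact abs_nonneg _
  have htE : (Ici N).indicator (singularValue (x + y)) ∈ E.carrier :=
    (E.mem_and_norm_le hzE fun k => by by_cases h : k ∈ Ici N <;> simp [h]).1
  have hdecomp : singularValue (x + y) = (Iio N).indicator (singularValue (x + y)) +
      (Ici N).indicator (singularValue (x + y)) := by
    ext k
    simp only [Pi.add_apply, indicator_apply, mem_Iio, mem_Ici]
    split_ifs <;> first | omega | simp
  rw [hdecomp]
  refine (E.norm_add_le _ hhE _ htE).trans ?_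
  have h1 := E.norm_add_le _ hdE _ (E.carrier.smul_mem (2 * δ) hwE)
  rw [E.norm_smul _ _ hwE, abs_of_nonneg (by positivity)] at h1
  have h2 : 2 * δ * E.norm w ≤ 2 * δ * C := by gcongr
  linarith

end compression

section schattenSpace

variable (E : SymmetricSequenceSpace) (H : Type*) [NormedAddCommGroup H] [InnerProductSpace ℂ H]
  [CompleteSpace H]

/-- The self-adjoint elements of `S_E(H)`, as a real linear space. -/
def schattenSelfAdjoint : Submodule ℝ (H →L[ℂ] H) where
  carrier := {x | x ∈ schatten E H ∧ IsSelfAdjoint x}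
  zero_mem' := ⟨(schatten E H).zero_mem, .zero _⟩
  add_mem' hx hy := ⟨(schatten E H).add_mem hx.1 hy.1, hx.2.add hy.2⟩
  smul_mem' c x hx := ⟨by
    have h : c • x = (c : ℂ) • x := by ext v; simp
    rw [h]
    exact (schatten E H).smul_mem _ hx.1, IsSelfAdjoint.smul (.all c) hx.2⟩

/-- The real ordered Banach space of self-adjoint elements of `S_E(H)`, with the norm
`‖x‖ = ‖(s_n(x))‖_E`. -/
def SchattenSpace : Type _ := ↥(schattenSelfAdjoint E H)

namespace SchattenSpace

instance : AddCommGroup (SchattenSpace E H) :=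
  inferInstanceAs (AddCommGroup ↥(schattenSelfAdjoint E H))

instance : Module ℝ (SchattenSpace E H) :=
  inferInstanceAs (Module ℝ ↥(schattenSelfAdjoint E H))

variable {E H} in
/-- An element of the Schatten space as a bounded operator on `H`. -/
def toOperator (x : SchattenSpace E H) : H →L[ℂ] H := x.1

instance : Norm (SchattenSpace E H) := ⟨fun x => E.norm (singularValue x.toOperator)⟩

theorem core [TopologicalSpace.SeparableSpace E.Space] :
    NormedSpace.Core ℝ (SchattenSpace E H) where
  norm_nonneg x := E.norm_nonneg x.2.1
  norm_smul c x := by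
    change E.norm (singularValue (c • x.1)) = |c| * E.norm (singularValue x.1)
    have h : c • x.1 = (c : ℂ) • x.1 := by ext v; simp
    have h2 : singularValue ((c : ℂ) • x.1) = |c| • singularValue x.1 := by
      ext n
      simpa using singularValue_smul (c : ℂ) x.1 n
    rw [h, h2, E.norm_smul _ _ x.2.1, abs_abs]
  norm_triangle x y := norm_singularValue_add_le E x.2.2 y.2.2 x.2.1 y.2.1
  norm_eq_zero_iff x := by
    constructor
    · intro h
      have h1 := congrFun (E.eq_zero_of_norm_eq_zero _ x.2.1 h) 0
      have h2 : ‖x.1‖ = 0 := (singularValue_zero_index x.1).symm.trans h1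
      exact Subtype.ext (norm_eq_zero.1 h2)
    · rintro rfl
      have h2 : singularValue (0 : H →L[ℂ] H) = 0 := by
        ext n
        simpa using singularValue_smul (0 : ℂ) (0 : H →L[ℂ] H) n
      change E.norm (singularValue (0 : H →L[ℂ] H)) = 0
      rw [h2, E.norm_zero]

instance [TopologicalSpace.SeparableSpace E.Space] : NormedAddCommGroup (SchattenSpace E H) :=
  NormedAddCommGroup.ofCore (core E H)

instance [TopologicalSpace.SeparableSpace E.Space] : NormedSpace ℝ (SchattenSpace E H) :=
  NormedSpace.ofCore (core E H)

end SchattenSpace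

end schattenSpace


/-- `E` contains an isomorphic copy of `ℓ₁`. -/
def SymmetricSequenceSpace.ContainsEllOne (E : SymmetricSequenceSpace) : Prop :=
  ∃ J : lp (fun _ : ℕ => ℝ) 1 →L[ℝ] E.Space, ∃ c > 0, ∀ a, c * ‖a‖ ≤ ‖J a‖

section order

/-- `0 ≤ T ≤ S` for operators from the ordered space `S_E(H)` to an ordered space `Z`. -/
def IsDominatedBy {E : SymmetricSequenceSpace} [TopologicalSpace.SeparableSpace E.Space]
    {H : Type*} [NormedAddCommGroup H] [InnerProductSpace ℂ H] [CompleteSpace H]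
    {Z : Type*} [NormedAddCommGroup Z] [NormedSpace ℝ Z] [PartialOrder Z]
    (T S : SchattenSpace E H →L[ℝ] Z) : Prop :=
  ∀ x : SchattenSpace E H, x.toOperator.IsPositive → 0 ≤ T x ∧ T x ≤ S x

variable (Z : Type*) [NormedAddCommGroup Z]

/-- An ordered normed space is normal. -/
def IsNormalOrdered [PartialOrder Z] : Prop :=
  ∃ N : ℝ, ∀ a z b : Z, a ≤ z → z ≤ b → ‖z‖ ≤ N * (‖a‖ + ‖b‖)

variable {Z} in
/-- An atom of a vector lattice: a positive `a ≠ 0` such that `[0, a]` consists of multiples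
of `a`. -/
def IsLatticeAtom [NormedSpace ℝ Z] [Lattice Z] (a : Z) : Prop :=
  0 < a ∧ ∀ b : Z, 0 ≤ b → b ≤ a → ∃ c : ℝ, b = c • a

/-- A Banach lattice is atomic: every nonzero positive element dominates an atom. -/
def IsAtomicBanachLattice [NormedSpace ℝ Z] [Lattice Z] : Prop :=
  ∀ z : Z, 0 < z → ∃ a : Z, IsLatticeAtom a ∧ a ≤ z

/-- A Banach lattice is order continuous: whenever a net decreases to `0` (equivalently, a
downward directed set has infimum `0`), the norms tend to `0`. -/
def IsOrderContinuousBanachLattice [Lattice Z] : Prop :=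
  ∀ D : Set Z, D.Nonempty → DirectedOn (· ≥ ·) D → IsGLB D 0 → ∀ ε > 0, ∃ z ∈ D, ‖z‖ < ε

end order

end

/-!
Let `X` denote the self-adjoint part of `S_E(H)`.

Suppose `E` contains no copy of `ℓ₁`. A functional `h` on `X` then has small tails: for `ε > 0` there
is a finite-dimensional `K` such that `h (e x e) ≤ ε` for all positive `x` in the unit ball, where
`e` is the projection onto `Kᗮ`. Otherwise one finds positive finite-rank operators `y n` in the
unit ball with orthogonal ranges and `h (y n)` bounded away from `0`; since the norm of `∑ a n • y n`
depends only on the eigenvalues, these eigenvalues, arranged in one sequence, span a copy of `ℓ₁` in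
`E` (`exists_forall_conj_orthogonal_le`). Now let `0 ≤ T ≤ S` with `S*` compact. For positive `f` in
the unit ball of `Z*` the functionals `f ∘ S` form a relatively compact set, so one `K` serves all of
them. The functionals `f ∘ T` inherit the small tails, being positive and dominated, and by the
Cauchy–Schwarz inequality (`abs_sub_conj_le`) they are uniformly close to `x ↦ f (T (p x p))`, with
`p` the projection onto `K`. Since `Z` is normal, every functional on `Z` is a difference of positive
ones of comparable norm (`exists_nonneg_dual_ge`). Hence `T*` is a norm limit of finite-rank
operators.

Suppose `E` contains `ℓ₁`. Then `E*` is not separable, so some functional on `E` has tails that are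
not norm-null; weighting diagonals in an orthonormal sequence of `H` by the absolute value of this
functional, and summing over suitable blocks, gives a positive operator `Q : X → ℓ₁` that maps a
bounded sequence `y n` to the unit vectors (`exists_toEllOne`). On the other side, a Banach lattice
whose order intervals are all compact is order continuous and atomic. For the latter, Krein–Milman
provides components of elements that are not atoms, and if `z > 0` dominated no atom, compactness
would yield one component halving all components of `z` approximately, itself included
(`isAtomicBanachLattice_of_isCompact_Icc`). So some `[0, s]` in `Z` is not compact, and contains a
sequence `t n` without convergent subsequences. The operators `T x = ∑ (Q x) n • t n` and
`S x = (∑ (Q x) n) • s` satisfy `0 ≤ T ≤ S`; `S` has rank one, and `T (y n) = t n`.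
-/

noncomputable section

/-! ### Truncation in a symmetric sequence space -/

namespace SymmetricSequenceSpace

variable (E : SymmetricSequenceSpace)

theorem indicator_mem {x : ℕ → ℝ} (hx : x ∈ E.carrier) (s : Set ℕ) :
    s.indicator x ∈ E.carrier ∧ E.norm (s.indicator x) ≤ E.norm x :=
  E.mem_and_norm_le hx fun k => by by_cases h : k ∈ s <;> simp [h]

instance : CompleteSpace E.Space := by
  refine Metric.complete_of_cauchySeq_tendsto fun u hu => ?_
  obtain ⟨x, hx, hlim⟩ := E.complete (fun i => (u i).1) (fun i => (u i).2) fun ε hε => by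
    obtain ⟨N, hN⟩ := Metric.cauchySeq_iff.1 hu ε hε
    exact ⟨N, fun i hi j hj => (dist_eq_norm (u i) (u j)).symm.trans_lt (hN i hi j hj)⟩
  refine ⟨(⟨x, hx⟩ : E.carrier), Metric.tendsto_atTop.2 fun ε hε => ?_⟩
  obtain ⟨N, hN⟩ := hlim ε hε
  exact ⟨N, fun i hi => (dist_eq_norm (u i) _).trans_lt (hN i hi)⟩

/-- Order continuity of the norm, in quantitative form: sequences dominated by a fixed `u ∈ E` are
small in norm as soon as they are uniformly small. -/
theorem exists_forall_norm_lt [TopologicalSpace.SeparableSpace E.Space] {u : ℕ → ℝ}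
    (hu : u ∈ E.carrier) {ε : ℝ} (hε : 0 < ε) :
    ∃ δ > 0, ∀ z : ℕ → ℝ, (∀ k, |z k| ≤ |u k|) → (∀ k, |z k| ≤ δ) → E.norm z < ε := by
  classical
  obtain ⟨N, hN⟩ := E.exists_norm_tail_lt hu (half_pos hε)
  set w : ℕ → ℝ := ∑ k ∈ Finset.range N, Pi.single k 1 with hw
  have hwE : w ∈ E.carrier := Submodule.sum_mem _ fun k _ => E.single_mem k 1
  have hw1 : ∀ k < N, w k = 1 := fun k hk => by
    simp [hw, Finset.sum_apply, Pi.single_apply, hk]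
  have hw0 := E.norm_nonneg hwE
  refine ⟨ε / (2 * (E.norm w + 1)), by positivity, fun z hz hzδ => ?_⟩
  set δ := ε / (2 * (E.norm w + 1)) with hδ
  have hδ0 : 0 < δ := by positivity
  have hzE := (E.mem_and_norm_le hu hz).1
  have h1 : E.norm ((Iio N).indicator z) ≤ E.norm (δ • w) :=
    (E.mem_and_norm_le (E.carrier.smul_mem δ hwE) fun k => by
      by_cases h : k ∈ Iio N
      · simpa [h, hw1 k h, abs_of_pos hδ0] using hzδ k
      · rw [indicator_of_notMem h, abs_zero]; exact abs_nonneg _).2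
  rw [E.norm_smul _ _ hwE, abs_of_pos hδ0] at h1
  have h2 : E.norm ((Ici N).indicator z) ≤ E.norm ((Ici N).indicator u) :=
    (E.mem_and_norm_le (E.indicator_mem hu _).1 fun k => by
      by_cases h : k ∈ Ici N
      · simpa [h] using hz k
      · simp [h]).2
  have hdecomp : z = (Iio N).indicator z + (Ici N).indicator z := by
    ext k
    simp only [Pi.add_apply, indicator_apply, mem_Iio, mem_Ici]
    split_ifs <;> first | omega | simp
  have h3 : δ * (E.norm w + 1) = ε / 2 := by rw [hδ]; field_simp
  rw [hdecomp]
  refine (E.norm_add_le _ (E.indicator_mem hzE _).1 _ (E.indicator_mem hzE _).1).trans_lt ?_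
  nlinarith

/-- The coordinate functionals on a symmetric sequence space. -/
def coord (k : ℕ) : E.Space →L[ℝ] ℝ :=
  LinearMap.mkContinuous
    { toFun := fun x => x.1 k
      map_add' := fun _ _ => rfl
      map_smul' := fun _ _ => rfl }
    (E.norm (Pi.single k 1))⁻¹ fun x => by
      rw [← div_eq_inv_mul, le_div_iff₀ (E.norm_single_pos k)]
      exact E.abs_apply_mul_le x.2 k

theorem coord_apply (k : ℕ) (x : E.Space) : E.coord k x = x.1 k := rfl

end SymmetricSequenceSpace

/-! ### Singular values and the functional calculus -/

section singularValues

variable {H : Type*} [NormedAddCommGroup H] [InnerProductSpace ℂ H] [CompleteSpace H]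

theorem singularValue_le_of_norm_apply_le {x z : H →L[ℂ] H} (h : ∀ v, ‖z v‖ ≤ ‖x v‖) (n : ℕ) :
    singularValue z n ≤ singularValue x n :=
  le_singularValue fun K hK hn => (singularValue_le z K hK hn).trans <|
    ContinuousLinearMap.opNorm_le_bound _ (norm_nonneg _) fun v =>
      (h _).trans ((x ∘L (Kᗮ).starProjection).le_opNorm v)

theorem singularValue_comp_left_le (a x : H →L[ℂ] H) (n : ℕ) :
    singularValue (a ∘L x) n ≤ ‖a‖ * singularValue x n := by
  have h := singularValue_smul (‖a‖ : ℂ) x n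
  rw [Complex.norm_real, norm_norm] at h
  rw [← h]
  refine singularValue_le_of_norm_apply_le (fun v => ?_) n
  simpa [norm_smul] using a.le_opNorm (x v)

theorem singularValue_comp_right_le (x b : H →L[ℂ] H) (n : ℕ) :
    singularValue (x ∘L b) n ≤ ‖b‖ * singularValue x n := by
  rcases (norm_nonneg b).eq_or_lt with h0 | hb
  · have : b = 0 := norm_eq_zero.1 h0.symm
    subst this
    have := singularValue_smul (0 : ℂ) (0 : H →L[ℂ] H) n
    simpa using this.le
  rw [← div_le_iff₀' hb]
  refine le_singularValue fun K hK hn => ?_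
  rw [div_le_iff₀' hb]
  -- a vector orthogonal to `b* K` is mapped by `b` into the orthogonal complement of `K`
  set L := K.map (ContinuousLinearMap.adjoint b : H →ₗ[ℂ] H) with hL
  refine (singularValue_le _ L inferInstance ((Submodule.finrank_map_le _ _).trans hn)).trans ?_
  refine ContinuousLinearMap.opNorm_le_bound _ (by positivity) fun v => ?_
  set u := Lᗮ.starProjection v with hu
  have huL : u ∈ Lᗮ := Lᗮ.starProjection_apply_mem v
  have hbu : b u ∈ Kᗮ := by
    intro k hk
    rw [← ContinuousLinearMap.adjoint_inner_left]
    exact huL _ (Submodule.mem_map_of_mem hk)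
  have huv : ‖u‖ ≤ ‖v‖ := Submodule.norm_starProjection_apply_le _ _
  calc ‖((x ∘L b) ∘L Lᗮ.starProjection) v‖ = ‖(x ∘L Kᗮ.starProjection) (b u)‖ := by
        simp only [ContinuousLinearMap.comp_apply, Submodule.starProjection_eq_self_iff.2 hbu]
        rfl
    _ ≤ ‖x ∘L Kᗮ.starProjection‖ * (‖b‖ * ‖v‖) := by
        refine (ContinuousLinearMap.le_opNorm _ _).trans ?_
        gcongr
        exact (b.le_opNorm u).trans (by gcongr)
    _ = _ := by ring

theorem inner_cfc_mul_self {g : ℝ → ℝ} (hg : Continuous g) (x : H →L[ℂ] H) (v : H) :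
    ‖cfc g x v‖ ^ 2 = (inner ℂ (cfc (fun t => g t * g t) x v) v).re := by
  rw [cfc_mul g g x hg.continuousOn hg.continuousOn]
  have hs : IsSelfAdjoint (cfc g x) := cfc_predicate g x
  have hm : (cfc g x * cfc g x) v = cfc g x (cfc g x v) := rfl
  rw [hm, ← hs.adjoint_eq, ContinuousLinearMap.adjoint_inner_left, hs.adjoint_eq,
    inner_self_eq_norm_sq_to_K (𝕜 := ℂ)]
  norm_cast

theorem norm_cfc_apply_le {g₁ g₂ : ℝ → ℝ} (h₁ : Continuous g₁) (h₂ : Continuous g₂)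
    (x : H →L[ℂ] H) (h : ∀ t ∈ spectrum ℝ x, |g₁ t| ≤ |g₂ t|) (v : H) :
    ‖cfc g₁ x v‖ ≤ ‖cfc g₂ x v‖ := by
  refine le_of_sq_le_sq ?_ (norm_nonneg _)
  rw [inner_cfc_mul_self h₁, inner_cfc_mul_self h₂]
  have hle : cfc (fun t => g₁ t * g₁ t) x ≤ cfc (fun t => g₂ t * g₂ t) x :=
    cfc_mono (fun t ht => by
      have := h t ht
      rw [← abs_mul_abs_self (g₁ t), ← abs_mul_abs_self (g₂ t)]
      gcongr) (h₁.mul h₁).continuousOn (h₂.mul h₂).continuousOn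
  have := ((ContinuousLinearMap.le_def _ _).1 hle).re_inner_nonneg_left v
  simp only [_root_.sub_apply, inner_sub_left, map_sub] at this
  simpa using this

end singularValues

/-! ### Operators in the Schatten space -/

namespace SchattenSpace

variable {E : SymmetricSequenceSpace} {H : Type*} [NormedAddCommGroup H] [InnerProductSpace ℂ H]
  [CompleteSpace H]

/-- A self-adjoint operator whose singular values lie in `E`, as an element of `S_E(H)`. -/
def mk (a : H →L[ℂ] H) (ha : singularValue a ∈ E.carrier) (hs : IsSelfAdjoint a) :
    SchattenSpace E H := (⟨a, ha, hs⟩ : ↥(schattenSelfAdjoint E H))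

theorem toOperator_mk (a : H →L[ℂ] H) (ha : singularValue a ∈ E.carrier) (hs : IsSelfAdjoint a) :
    (mk a ha hs).toOperator = a := rfl

theorem ext {x y : SchattenSpace E H} (h : x.toOperator = y.toOperator) : x = y :=
  Subtype.ext h

theorem toOperator_add (x y : SchattenSpace E H) :
    (x + y).toOperator = x.toOperator + y.toOperator := rfl

theorem toOperator_sub (x y : SchattenSpace E H) :
    (x - y).toOperator = x.toOperator - y.toOperator := rfl

theorem toOperator_smul (c : ℝ) (x : SchattenSpace E H) :
    (c • x).toOperator = c • x.toOperator := rfl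

theorem toOperator_sum {ι : Type*} (s : Finset ι) (x : ι → SchattenSpace E H) :
    (∑ i ∈ s, x i).toOperator = ∑ i ∈ s, (x i).toOperator :=
  map_sum (schattenSelfAdjoint E H).subtype x s

theorem isSelfAdjoint (x : SchattenSpace E H) : IsSelfAdjoint x.toOperator := x.2.2

theorem mem (x : SchattenSpace E H) : singularValue x.toOperator ∈ E.carrier := x.2.1

theorem norm_def (x : SchattenSpace E H) : ‖x‖ = E.norm (singularValue x.toOperator) := rfl

/-- Operators whose singular values are dominated by those of `x` are in the Schatten ideal. -/
theorem mem_and_norm_le_of_singularValue_le (x : SchattenSpace E H) {z : H →L[ℂ] H} {c : ℝ}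
    (hc : 0 ≤ c) (h : ∀ n, singularValue z n ≤ c * singularValue x.toOperator n) :
    singularValue z ∈ E.carrier ∧ E.norm (singularValue z) ≤ c * ‖x‖ := by
  have h1 := E.mem_and_norm_le (E.carrier.smul_mem c x.mem) (y := singularValue z) fun k => by
    rw [abs_of_nonneg (singularValue_nonneg z k)]
    exact (h k).trans (le_abs_self _)
  rwa [E.norm_smul _ _ x.mem, abs_of_nonneg hc] at h1

/-- Every element of the Schatten space is a difference of two positive ones of no larger norm. -/
theorem exists_sub_of_isPositive (x : SchattenSpace E H) :
    ∃ y z : SchattenSpace E H, y.toOperator.IsPositive ∧ z.toOperator.IsPositive ∧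
      ‖y‖ ≤ ‖x‖ ∧ ‖z‖ ≤ ‖x‖ ∧ x = y - z := by
  have hid : cfc (fun t : ℝ => t) x.toOperator = x.toOperator := cfc_id' ℝ _ x.isSelfAdjoint
  have key : ∀ g : ℝ → ℝ, Continuous g → (∀ t, |g t| ≤ |t|) → ∀ n,
      singularValue (cfc g x.toOperator) n ≤ 1 * singularValue x.toOperator n := fun g hg h n => by
    rw [one_mul]
    refine singularValue_le_of_norm_apply_le (fun v => ?_) n
    have := norm_cfc_apply_le hg continuous_id' x.toOperator (fun t _ => h t) v
    rwa [hid] at this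
  have hc1 : Continuous fun t : ℝ => max t 0 := by fun_prop
  have hc2 : Continuous fun t : ℝ => max (-t) 0 := by fun_prop
  have h1 := mem_and_norm_le_of_singularValue_le x zero_le_one
    (key (fun t => max t 0) hc1 fun t => by
      rcases max_cases t 0 with h | h <;> simp [h.1])
  have h2 := mem_and_norm_le_of_singularValue_le x zero_le_one
    (key (fun t => max (-t) 0) hc2 fun t => by
      rcases max_cases (-t) 0 with h | h <;> simp [h.1])
  rw [one_mul] at h1 h2
  refine ⟨mk _ h1.1 (cfc_predicate _ _), mk _ h2.1 (cfc_predicate _ _),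
    (ContinuousLinearMap.nonneg_iff_isPositive _).1 (cfc_nonneg fun t _ => le_max_right _ _),
    (ContinuousLinearMap.nonneg_iff_isPositive _).1 (cfc_nonneg fun t _ => le_max_right _ _),
    h1.2, h2.2, ext ?_⟩
  rw [toOperator_sub, toOperator_mk, toOperator_mk,
    ← cfc_sub _ _ _ hc1.continuousOn hc2.continuousOn]
  conv_lhs => rw [← hid]
  congr 1
  ext t
  rcases le_total t 0 with h | h
  · rw [max_eq_right h, max_eq_left (by linarith)]; ring
  · rw [max_eq_left h, max_eq_right (by linarith)]; ring

theorem singularValue_conj_le (a x : H →L[ℂ] H) (n : ℕ) :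
    singularValue (ContinuousLinearMap.adjoint a ∘L x ∘L a) n ≤ ‖a‖ ^ 2 * singularValue x n := by
  refine (singularValue_comp_left_le _ _ n).trans ?_
  rw [LinearIsometryEquiv.norm_map, sq, mul_assoc]
  gcongr
  exact singularValue_comp_right_le _ _ n

variable [TopologicalSpace.SeparableSpace E.Space]

/-- The map `x ↦ a* x a` on the Schatten space. -/
def conj (a : H →L[ℂ] H) : SchattenSpace E H →L[ℝ] SchattenSpace E H :=
  LinearMap.mkContinuous
    { toFun := fun x => mk (ContinuousLinearMap.adjoint a ∘L x.toOperator ∘L a)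
        (mem_and_norm_le_of_singularValue_le x (by positivity)
          (singularValue_conj_le a x.toOperator)).1
        (x.isSelfAdjoint.adjoint_conj a)
      map_add' := fun x y => ext (by
        ext v
        simp [toOperator_mk, toOperator_add])
      map_smul' := fun c x => ext (by
        ext v
        simp [toOperator_mk, toOperator_smul]) }
    (‖a‖ ^ 2) fun x => (mem_and_norm_le_of_singularValue_le x (by positivity)
      (singularValue_conj_le a x.toOperator)).2

theorem toOperator_conj (a : H →L[ℂ] H) (x : SchattenSpace E H) :
    (conj a x).toOperator = ContinuousLinearMap.adjoint a ∘L x.toOperator ∘L a := rfl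

theorem norm_conj_le (a : H →L[ℂ] H) (x : SchattenSpace E H) : ‖conj a x‖ ≤ ‖a‖ ^ 2 * ‖x‖ :=
  (mem_and_norm_le_of_singularValue_le x (by positivity) (singularValue_conj_le a x.toOperator)).2

theorem conj_isPositive (a : H →L[ℂ] H) {x : SchattenSpace E H} (hx : x.toOperator.IsPositive) :
    (conj a x).toOperator.IsPositive := hx.adjoint_conj a

theorem conj_conj (a b : H →L[ℂ] H) (x : SchattenSpace E H) :
    conj b (conj a x) = conj (a ∘L b) x :=
  ext (by simp only [toOperator_conj, ContinuousLinearMap.adjoint_comp]; rfl)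

theorem norm_conj_starProjection_le (K : Submodule ℂ H) [K.HasOrthogonalProjection]
    (x : SchattenSpace E H) : ‖conj K.starProjection x‖ ≤ ‖x‖ := by
  refine (norm_conj_le _ x).trans ?_
  have h := K.starProjection_norm_le
  have h2 : ‖K.starProjection‖ ^ 2 ≤ 1 := pow_le_one₀ (norm_nonneg _) h
  nlinarith [norm_nonneg x]

/-- Positive finite-rank operators below a positive `x` approximate `x` in norm. The approximant is
`(x - δ)₊` for small `δ > 0`: it is bounded below by `δ` on its range, which is therefore
finite-dimensional because the singular values of `x` tend to `0`. -/
theorem exists_finiteRank_approx {x : SchattenSpace E H} (hx : x.toOperator.IsPositive) {ε : ℝ}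
    (hε : 0 < ε) :
    ∃ y : SchattenSpace E H, y.toOperator.IsPositive ∧ ‖x - y‖ < ε ∧
      FiniteDimensional ℂ (LinearMap.range y.toOperator.toLinearMap) ∧
      ∀ v, ‖y.toOperator v‖ ≤ ‖x.toOperator v‖ := by
  have hx0 : 0 ≤ x.toOperator := (ContinuousLinearMap.nonneg_iff_isPositive _).2 hx
  have hid : cfc (fun t : ℝ => t) x.toOperator = x.toOperator := cfc_id' ℝ _ x.isSelfAdjoint
  have hspec : ∀ t ∈ spectrum ℝ x.toOperator, 0 ≤ t := fun t ht =>
    spectrum_nonneg_of_nonneg hx0 ht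
  obtain ⟨δ, hδ, hsmall⟩ := E.exists_forall_norm_lt x.mem hε
  set f : ℝ → ℝ := fun t => max (t - δ) 0 with hf
  have hfc : Continuous f := by fun_prop
  have hf0 : ∀ t, 0 ≤ f t := fun t => le_max_right _ _
  have hft : ∀ t ∈ spectrum ℝ x.toOperator, |f t| ≤ |t| := fun t ht => by
    have := hspec t ht
    rw [abs_of_nonneg (hf0 t), abs_of_nonneg this]
    exact max_le (by linarith) this
  have happly : ∀ v, ‖cfc f x.toOperator v‖ ≤ ‖x.toOperator v‖ := fun v => by
    have := norm_cfc_apply_le hfc continuous_id' x.toOperator hft v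
    rwa [hid] at this
  have hmem := mem_and_norm_le_of_singularValue_le x zero_le_one (z := cfc f x.toOperator)
    fun n => by
      rw [one_mul]
      exact singularValue_le_of_norm_apply_le happly n
  have hdiff : x.toOperator - cfc f x.toOperator = cfc (fun t => t - f t) x.toOperator := by
    rw [cfc_sub _ _ _ continuous_id'.continuousOn hfc.continuousOn, hid]
  refine ⟨mk _ hmem.1 (cfc_predicate _ _),
    (ContinuousLinearMap.nonneg_iff_isPositive _).1 (cfc_nonneg fun t _ => hf0 t), ?_, ?_, happly⟩
  · have hd : ∀ t ∈ spectrum ℝ x.toOperator, 0 ≤ t - f t ∧ t - f t ≤ δ ∧ t - f t ≤ t := by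
      intro t ht
      have h0 := hspec t ht
      have h1 := hf0 t
      refine ⟨?_, ?_, by linarith⟩
      · have : f t ≤ t := max_le (by linarith) h0
        linarith
      · have : t - δ ≤ f t := le_max_left _ _
        linarith
    refine hsmall _ (fun k => ?_) fun k => ?_
    · rw [abs_of_nonneg (singularValue_nonneg _ _), abs_of_nonneg (singularValue_nonneg _ _),
        toOperator_sub, toOperator_mk, hdiff]
      refine singularValue_le_of_norm_apply_le (fun v => ?_) k
      have := norm_cfc_apply_le (g₁ := fun t => t - f t) (by fun_prop) continuous_id' x.toOperator
        (fun t ht => by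
          rw [abs_of_nonneg (hd t ht).1, abs_of_nonneg (hspec t ht)]
          exact (hd t ht).2.2) v
      rwa [hid] at this
    · rw [abs_of_nonneg (singularValue_nonneg _ _), toOperator_sub, toOperator_mk, hdiff]
      refine (singularValue_antitone _ (Nat.zero_le k)).trans ?_
      rw [singularValue_zero_index]
      refine norm_cfc_le hδ.le fun t ht => ?_
      rw [Real.norm_eq_abs, abs_of_nonneg (hd t ht).1]
      exact (hd t ht).2.1
  · -- `x` is bounded below by `δ` on the range and strictly less than `δ` on `Kᗮ`
    obtain ⟨m, hm⟩ := exists_singularValue_lt E x.mem hδ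
    obtain ⟨K, hK, -, hKδ⟩ := exists_lt_of_singularValue_lt hm
    rw [toOperator_mk]
    have hbelow : ∀ w, δ * ‖cfc f x.toOperator w‖ ≤ ‖x.toOperator (cfc f x.toOperator w)‖ := by
      intro w
      have h1 := norm_cfc_apply_le (g₁ := fun t => δ * f t) (g₂ := fun t => t * f t) (by fun_prop)
        (by fun_prop) x.toOperator (fun t ht => by
          rw [abs_mul, abs_mul]
          rcases le_total t δ with h | h
          · have : f t = 0 := max_eq_right (by linarith)
            simp [this]
          · gcongr) w
      rw [cfc_const_mul _ _ _ hfc.continuousOn,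
        cfc_mul _ _ _ continuous_id'.continuousOn hfc.continuousOn, hid] at h1
      have h2 : ‖(δ • cfc f x.toOperator) w‖ = δ * ‖cfc f x.toOperator w‖ := by
        rw [_root_.smul_apply, norm_smul, Real.norm_eq_abs, abs_of_pos hδ]
      rw [h2] at h1
      exact h1
    let Φ : LinearMap.range (cfc f x.toOperator).toLinearMap →ₗ[ℂ] K :=
      K.orthogonalProjectionOnto.toLinearMap ∘ₗ Submodule.subtype _
    refine FiniteDimensional.of_injective Φ ((injective_iff_map_eq_zero Φ).2 ?_)
    rintro ⟨_, w, rfl⟩ h0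
    have hmemK : cfc f x.toOperator w ∈ Kᗮ := by
      rw [← Submodule.starProjection_apply_eq_zero_iff]
      exact congrArg Subtype.val h0
    have h1 : ‖x.toOperator (cfc f x.toOperator w)‖ ≤
        ‖x.toOperator ∘L Kᗮ.starProjection‖ * ‖cfc f x.toOperator w‖ := by
      have := (x.toOperator ∘L Kᗮ.starProjection).le_opNorm (cfc f x.toOperator w)
      rwa [ContinuousLinearMap.comp_apply, Submodule.starProjection_eq_self_iff.2 hmemK] at this
    have h2 := hbelow w
    have h3 : ‖cfc f x.toOperator w‖ = 0 := by
      by_contra hne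
      have : 0 < ‖cfc f x.toOperator w‖ := lt_of_le_of_ne (norm_nonneg _) (Ne.symm hne)
      nlinarith
    exact Subtype.ext (norm_eq_zero.1 h3)

end SchattenSpace

/-! ### Diagonal operators -/

section diagonal

variable {H : Type*} [NormedAddCommGroup H] [InnerProductSpace ℂ H]

/-- The operator `∑ i, b i • ⟨v i, ·⟩ v i` that is diagonal in the finite system `v`. -/
def diagOp {ι : Type*} [Fintype ι] (v : ι → H) (b : ι → ℝ) : H →L[ℂ] H :=
  ∑ i, (b i : ℂ) • InnerProductSpace.rankOne ℂ (v i) (v i)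

variable {ι : Type*} [Fintype ι] {v : ι → H} {b : ι → ℝ}

theorem diagOp_apply (w : H) : diagOp v b w = ∑ i, ((b i : ℂ) * inner ℂ (v i) w) • v i := by
  simp only [diagOp, _root_.sum_apply, _root_.smul_apply, InnerProductSpace.rankOne_apply,
    smul_smul]

theorem inner_diagOp_self (hv : Orthonormal ℂ v) (i : ι) :
    inner ℂ (diagOp v b (v i)) (v i) = (b i : ℂ) := by
  classical
  rw [diagOp_apply, sum_inner, Finset.sum_eq_single i]
  · rw [inner_smul_left, inner_self_eq_norm_sq_to_K, hv.1 i]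
    simp
  · intro j _ hj
    rw [inner_smul_left, hv.2 hj, mul_zero]
  · simp

theorem inner_diagOp_of_orthogonal {w : H} (hw : ∀ i, inner ℂ (v i) w = 0) :
    inner ℂ (diagOp v b w) w = 0 := by
  simp [diagOp_apply, hw]

variable [CompleteSpace H]

theorem diagOp_isSelfAdjoint : IsSelfAdjoint (diagOp v b) := by
  refine isSelfAdjoint_sum _ fun i _ => ?_
  refine IsSelfAdjoint.smul ?_ (InnerProductSpace.isPositive_rankOne_self (v i)).isSelfAdjoint
  exact Complex.conj_ofReal _

theorem singularValue_diagOp_le (hv : Orthonormal ℂ v) {β : ℕ → ℝ} (hβ : ∃ C, ∀ k, |β k| ≤ C)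
    {j : ι → ℕ} (hj : Function.Injective j) (hb : ∀ i, b i = β (j i)) (n : ℕ) :
    singularValue (diagOp v b) n ≤ decRearr β n := by
  classical
  obtain ⟨C, hC⟩ := hβ
  refine le_decRearr fun F hF => ?_
  set s := ⨆ k : {k : ℕ // k ∉ F}, |β k| with hs
  have hs0 : 0 ≤ s := Real.iSup_nonneg fun _ => abs_nonneg _
  have hsF : ∀ k ∉ F, |β k| ≤ s := fun k hk => by
    refine le_ciSup (f := fun k : {k : ℕ // k ∉ F} => |β k|) ⟨C, ?_⟩ ⟨k, hk⟩
    rintro _ ⟨i, rfl⟩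
    exact hC i
  let F' : Finset ι := Finset.univ.filter fun i => j i ∈ F
  have hF' : F'.card ≤ n := by
    refine le_trans (Finset.card_le_card_of_injOn j (fun i hi => ?_) hj.injOn) hF
    simpa [F'] using hi
  let L : Submodule ℂ H := Submodule.span ℂ (F'.image v)
  have hL : FiniteDimensional ℂ L := FiniteDimensional.span_finset ℂ _
  have hLn : Module.finrank ℂ L ≤ n :=
    (finrank_span_finset_le_card _).trans (Finset.card_image_le.trans hF')
  refine (singularValue_le _ L hL hLn).trans ?_
  refine ContinuousLinearMap.opNorm_le_bound _ hs0 fun w₀ => ?_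
  set w := Lᗮ.starProjection w₀ with hw
  have hww : ‖w‖ ≤ ‖w₀‖ := Submodule.norm_starProjection_apply_le _ _
  have hwL : w ∈ Lᗮ := Lᗮ.starProjection_apply_mem w₀
  have hzero : ∀ i ∈ F', inner ℂ (v i) w = 0 := fun i hi =>
    hwL _ (Submodule.subset_span (by simpa using ⟨i, hi, rfl⟩))
  change ‖diagOp v b w‖ ≤ _
  refine le_trans ?_ (mul_le_mul_of_nonneg_left hww hs0)
  refine le_of_sq_le_sq ?_ (by positivity)
  have hnorm : ‖diagOp v b w‖ ^ 2 = ∑ i, (b i) ^ 2 * ‖inner ℂ (v i) w‖ ^ 2 := by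
    have h1 : ((‖diagOp v b w‖ ^ 2 : ℝ) : ℂ) =
        ((∑ i, (b i) ^ 2 * ‖inner ℂ (v i) w‖ ^ 2 : ℝ) : ℂ) := by
      have h2 := inner_self_eq_norm_sq_to_K (𝕜 := ℂ) (diagOp v b w)
      rw [diagOp_apply, hv.inner_sum, ← diagOp_apply] at h2
      push_cast
      refine h2.symm.trans (Finset.sum_congr rfl fun i _ => ?_)
      rw [map_mul, Complex.conj_ofReal, mul_mul_mul_comm, Complex.conj_mul']
      ring
    exact_mod_cast h1
  rw [hnorm, mul_pow]
  calc ∑ i, (b i) ^ 2 * ‖inner ℂ (v i) w‖ ^ 2 ≤ ∑ i, s ^ 2 * ‖inner ℂ (v i) w‖ ^ 2 := by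
        refine Finset.sum_le_sum fun i _ => ?_
        by_cases h : i ∈ F'
        · simp [hzero i h]
        · have h1 : |b i| ≤ s := by
            rw [hb i]
            exact hsF _ (by simpa [F'] using h)
          have h2 : b i ^ 2 ≤ s ^ 2 := by
            rw [← sq_abs (b i)]; gcongr
          gcongr
    _ = s ^ 2 * ∑ i, ‖inner ℂ (v i) w‖ ^ 2 := by rw [Finset.mul_sum]
    _ ≤ s ^ 2 * ‖w‖ ^ 2 := by
        gcongr
        exact hv.sum_inner_products_le w

theorem singularValue_diagOp_mem (E : SymmetricSequenceSpace) (hv : Orthonormal ℂ v) {β : ℕ → ℝ}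
    (hβ : β ∈ E.carrier) {j : ι → ℕ} (hj : Function.Injective j) (hb : ∀ i, b i = β (j i)) :
    singularValue (diagOp v b) ∈ E.carrier ∧ E.norm (singularValue (diagOp v b)) ≤ E.norm β := by
  refine E.symmetric β hβ _ ⟨singularValue (diagOp v b) 0, fun n => ?_⟩ fun n => ?_
  · rw [abs_of_nonneg (singularValue_nonneg _ _)]
    exact singularValue_antitone _ (Nat.zero_le n)
  · exact (decRearr_le_of_antitone (singularValue_nonneg _) (singularValue_antitone _) n).trans
      (singularValue_diagOp_le hv (E.bounded_of_mem β hβ) hj hb n)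

/-- Spectral theorem for finite-rank elements of the Schatten space. -/
theorem SchattenSpace.exists_eq_diagOp {E : SymmetricSequenceSpace} (y : SchattenSpace E H)
    (hfin : FiniteDimensional ℂ (LinearMap.range y.toOperator.toLinearMap)) :
    ∃ (m : ℕ) (u : Fin m → H) (l : Fin m → ℝ), Orthonormal ℂ u ∧
      (∀ i, u i ∈ LinearMap.range y.toOperator.toLinearMap) ∧
      E.norm (padZero l) ≤ E.norm (singularValue y.toOperator) ∧ y.toOperator = diagOp u l := by
  set R := LinearMap.range y.toOperator.toLinearMap with hR
  have hy := y.isSelfAdjoint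
  have hyR : ∀ w, y.toOperator w ∈ R := fun w => ⟨w, rfl⟩
  set e := cBasis hy R with he
  have hev : ∀ i, y.toOperator (e i) = (cEig hy R i : ℂ) • (e i : H) := by
    intro i
    have h1 : compression y.toOperator R (e i) = (cEig hy R i : ℂ) • e i :=
      (compression_isSymmetric hy R).apply_eigenvectorBasis rfl i
    have h2 : R.starProjection (y.toOperator (e i)) = (cEig hy R i : ℂ) • (e i : H) :=
      congrArg Subtype.val h1
    rwa [Submodule.starProjection_eq_self_iff.2 (hyR _)] at h2
  refine ⟨_, fun i => (e i : H), cEig hy R, ?_, fun i => (e i).2, ?_, ?_⟩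
  · exact e.orthonormal.comp_linearIsometry R.subtypeₗᵢ
  · refine (E.symmetric _ y.mem _ (padZero_bounded _) fun k => ?_).2
    exact (decRearr_cEig_le hy R k).trans
      (le_decRearr_of_antitone (singularValue_nonneg _) (singularValue_antitone _) k)
  · ext w
    have h1 := congrArg Subtype.val (e.sum_repr' ⟨y.toOperator w, hyR w⟩)
    rw [diagOp_apply]
    simp only [Submodule.coe_sum, Submodule.coe_smul, Submodule.coe_inner] at h1
    rw [← h1]
    refine Finset.sum_congr rfl fun i _ => ?_
    rw [← ContinuousLinearMap.adjoint_inner_left, hy.adjoint_eq, hev, inner_smul_left,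
      Complex.conj_ofReal]

end diagonal

/-! ### Copies of `ℓ₁` -/

theorem summable_norm_ellOne (a : lp (fun _ : ℕ => ℝ) 1) : Summable fun n => ‖a n‖ := by
  simpa using (memℓp_gen_iff (by simp : 0 < (1 : ENNReal).toReal)).1 a.2

theorem norm_ellOne (a : lp (fun _ : ℕ => ℝ) 1) : ‖a‖ = ∑' n, ‖a n‖ := by
  simpa using lp.norm_eq_tsum_rpow (by simp : 0 < (1 : ENNReal).toReal) a

section lift

variable {X : Type*} [NormedAddCommGroup X] [NormedSpace ℝ X] {e : ℕ → X} {C : ℝ}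

theorem norm_ellOne_smul_le (he : ∀ n, ‖e n‖ ≤ C) (a : lp (fun _ : ℕ => ℝ) 1) (n : ℕ) :
    ‖a n • e n‖ ≤ ‖a n‖ * C := by
  rw [norm_smul]
  gcongr
  exact he n

variable [CompleteSpace X]

theorem summable_ellOne_smul (he : ∀ n, ‖e n‖ ≤ C) (a : lp (fun _ : ℕ => ℝ) 1) :
    Summable fun n => a n • e n :=
  Summable.of_norm_bounded ((summable_norm_ellOne a).mul_right C) (norm_ellOne_smul_le he a)

/-- The operator from `ℓ₁` that takes the unit vectors to a given bounded sequence. -/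
def ellOneLift (e : ℕ → X) (C : ℝ) (he : ∀ n, ‖e n‖ ≤ C) : lp (fun _ : ℕ => ℝ) 1 →L[ℝ] X :=
  LinearMap.mkContinuous
    { toFun := fun a => ∑' n, a n • e n
      map_add' := fun a b => by
        rw [← (summable_ellOne_smul he a).tsum_add (summable_ellOne_smul he b)]
        exact tsum_congr fun n => by rw [← add_smul]; rfl
      map_smul' := fun c a => by
        rw [RingHom.id_apply, ← (summable_ellOne_smul he a).tsum_const_smul]
        exact tsum_congr fun n => by rw [smul_smul]; rfl }
    C fun a => by
      refine (tsum_of_norm_bounded ((summable_norm_ellOne a).mul_right C).hasSum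
        (norm_ellOne_smul_le he a)).trans_eq ?_
      rw [norm_ellOne, tsum_mul_right, mul_comm]

theorem hasSum_ellOneLift (he : ∀ n, ‖e n‖ ≤ C) (a : lp (fun _ : ℕ => ℝ) 1) :
    HasSum (fun n => a n • e n) (ellOneLift e C he a) :=
  (summable_ellOne_smul he a).hasSum

end lift

/-! ### Tails of positive functionals -/

namespace SchattenSpace

variable {E : SymmetricSequenceSpace} {H : Type*} [NormedAddCommGroup H] [InnerProductSpace ℂ H]
  [CompleteSpace H] [TopologicalSpace.SeparableSpace E.Space]

/-- A bounded orthogonal sequence of diagonal operators on which a bounded functional is bounded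
below by `ε > 0` yields a copy of `ℓ₁` in `E`, spanned by the sequences of eigenvalues. -/
theorem containsEllOne_of_orthogonal_sequence (h : SchattenSpace E H →L[ℝ] ℝ) {ε : ℝ} (hε : 0 < ε)
    (m : ℕ → ℕ) (u : (Σ n, Fin (m n)) → H) (hu : Orthonormal ℂ u) (l : ∀ n, Fin (m n) → ℝ) {C : ℝ}
    (hl : ∀ n, E.norm (padZero (l n)) ≤ C) (y : ℕ → SchattenSpace E H)
    (hy : ∀ n, (y n).toOperator = diagOp (fun i => u ⟨n, i⟩) (l n)) (hh : ∀ n, ε ≤ h (y n)) :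
    E.ContainsEllOne := by
  -- the eigenvalues of all operators, arranged in one sequence
  let P : ℕ → ℕ → ℝ := fun n => padZero (l n)
  set L : ℕ → ℝ := fun k => P k.unpair.1 k.unpair.2 with hL
  have hLpair : ∀ n i, L (Nat.pair n i) = padZero (l n) i := fun n i => by
    change P (Nat.pair n i).unpair.1 (Nat.pair n i).unpair.2 = P n i
    rw [Nat.unpair_pair]
  have hmem : ∀ n, (fun k => if k.unpair.1 = n then L k else 0) ∈ E.carrier ∧
      E.norm (fun k => if k.unpair.1 = n then L k else 0) ≤ E.norm (padZero (l n)) := fun n =>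
    E.mem_and_norm_le_of_dom (padZero_mem E (l n)) (Nat.pair n) fun k => by
      by_cases hk : k.unpair.1 = n
      · exact Or.inr ⟨k.unpair.2, by rw [← hk, Nat.pair_unpair], by
          rw [if_pos hk, ← hLpair, ← hk, Nat.pair_unpair]⟩
      · exact Or.inl (if_neg hk)
  let e : ℕ → E.Space := fun n => (⟨_, (hmem n).1⟩ : E.carrier)
  have he : ∀ n, ‖e n‖ ≤ C := fun n => (hmem n).2.trans (hl n)
  have hJ : ∀ a k, (ellOneLift e C he a).1 k = a k.unpair.1 * L k := by
    intro a k
    have h1 := (E.coord k).hasSum (hasSum_ellOneLift he a)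
    refine h1.unique ?_
    have h2 : ∀ n, E.coord k (a n • e n) = a n * if k.unpair.1 = n then L k else 0 := fun n => by
      rw [map_smul]
      rfl
    convert hasSum_single k.unpair.1 ?_ using 1
    · rw [h2, if_pos rfl]
    · intro n hn
      rw [h2, if_neg (Ne.symm hn), mul_zero]
  refine ⟨ellOneLift e C he, ε / (‖h‖ + 1), by positivity, fun a => ?_⟩
  set x := ellOneLift e C he a with hx
  have hpartial : ∀ N, ε * ∑ n ∈ Finset.range N, ‖a n‖ ≤ (‖h‖ + 1) * ‖x‖ := by
    intro N
    set Y : SchattenSpace E H := ∑ n ∈ Finset.range N, ‖a n‖ • y n with hY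
    have hhY : ε * ∑ n ∈ Finset.range N, ‖a n‖ ≤ h Y := by
      rw [hY, map_sum, Finset.mul_sum]
      refine Finset.sum_le_sum fun n _ => ?_
      rw [map_smul, smul_eq_mul, mul_comm]
      gcongr
      exact hh n
    let ι := Σ n : Fin N, Fin (m n)
    let emb : ι → Σ n, Fin (m n) := fun i => ⟨i.1, i.2⟩
    have hemb : Function.Injective emb := by
      rintro ⟨⟨n, hn⟩, i⟩ ⟨⟨n', hn'⟩, i'⟩ hi
      simp only [emb, Sigma.mk.injEq] at hi
      obtain ⟨rfl, hi⟩ := hi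
      cases hi
      rfl
    let j : ι → ℕ := fun i => Nat.pair i.1 i.2
    have hj : Function.Injective j := by
      rintro ⟨⟨n, hn⟩, i⟩ ⟨⟨n', hn'⟩, i'⟩ hi
      simp only [j, Nat.pair_eq_pair] at hi
      obtain ⟨rfl, hi⟩ := hi
      rw [Fin.ext hi]
    let b : ι → ℝ := fun i => ‖a i.1‖ * l i.1 i.2
    have hYop : Y.toOperator = diagOp (u ∘ emb) b := by
      rw [hY, toOperator_sum, ← Fin.sum_univ_eq_sum_range (fun n => (‖a n‖ • y n).toOperator)]
      ext w
      rw [diagOp_apply, Fintype.sum_sigma, _root_.sum_apply]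
      refine Finset.sum_congr rfl fun n _ => ?_
      rw [toOperator_smul, _root_.smul_apply, hy, diagOp_apply, Finset.smul_sum]
      refine Finset.sum_congr rfl fun i _ => ?_
      rw [← Complex.coe_smul, smul_smul, ← mul_assoc]
      simp [b, emb]
    set β : ℕ → ℝ := fun k => ‖a k.unpair.1‖ * L k with hβ
    have hβE : β ∈ E.carrier ∧ E.norm β ≤ ‖x‖ := E.mem_and_norm_le x.2 fun k => by
      rw [hJ, hβ, abs_mul, abs_mul, Real.norm_eq_abs, abs_abs]
    have hYn : ‖Y‖ ≤ ‖x‖ := by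
      rw [norm_def, hYop]
      refine (singularValue_diagOp_mem E (hu.comp emb hemb) hβE.1 hj fun i => ?_).2.trans hβE.2
      simp only [hβ, j, b, hLpair, Nat.unpair_pair, padZero_fin]
    calc _ ≤ h Y := hhY
      _ ≤ ‖h‖ * ‖Y‖ := (le_abs_self _).trans (h.le_opNorm Y)
      _ ≤ (‖h‖ + 1) * ‖x‖ := by
          have := norm_nonneg h
          gcongr
          linarith
  have h1 : ‖a‖ ≤ (‖h‖ + 1) * ‖x‖ / ε := by
    rw [norm_ellOne]
    refine Real.tsum_le_of_sum_range_le (fun n => norm_nonneg _) fun N => ?_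
    rw [le_div_iff₀' hε]
    exact hpartial N
  rw [le_div_iff₀ hε] at h1
  rw [div_mul_eq_mul_div, div_le_iff₀ (by positivity)]
  linarith

/-- If `E` contains no copy of `ℓ₁`, then positive functionals on the Schatten space have small
tails off finite-dimensional subspaces. Otherwise finite-rank positive operators with orthogonal
ranges, on which the functional stays away from `0`, could be chosen one after the other. -/
theorem exists_forall_conj_orthogonal_le (hE : ¬ E.ContainsEllOne)
    (h : SchattenSpace E H →L[ℝ] ℝ) {ε : ℝ} (hε : 0 < ε) :
    ∃ K : Submodule ℂ H, FiniteDimensional ℂ K ∧ ∀ x : SchattenSpace E H,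
      x.toOperator.IsPositive → ‖x‖ ≤ 1 → h (conj Kᗮ.starProjection x) ≤ ε := by
  by_contra! hcon
  have hstep : ∀ K : {K : Submodule ℂ H // FiniteDimensional ℂ K},
      ∃ (m : ℕ) (u : Fin m → H) (l : Fin m → ℝ) (y : SchattenSpace E H), Orthonormal ℂ u ∧
        (∀ i, u i ∈ K.1ᗮ) ∧ E.norm (padZero l) ≤ 1 ∧ y.toOperator = diagOp u l ∧
        ε / 2 ≤ h y := by
    rintro ⟨K, hK⟩
    obtain ⟨x, hx, hx1, hxε⟩ := hcon K hK
    set z := conj Kᗮ.starProjection x with hz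
    have hzpos : z.toOperator.IsPositive := conj_isPositive _ hx
    obtain ⟨y, hypos, hyz, hfin, hyle⟩ := exists_finiteRank_approx hzpos
      (show 0 < ε / (2 * (‖h‖ + 1)) by positivity)
    obtain ⟨m, u, l, hu, huR, hl, hyd⟩ := y.exists_eq_diagOp hfin
    refine ⟨m, u, l, y, hu, fun i => ?_, hl.trans ?_, hyd, ?_⟩
    · obtain ⟨w, hw⟩ := huR i
      rw [← hw]
      intro k hk
      have hzk : z.toOperator k = 0 := by
        rw [hz, toOperator_conj]
        have : Kᗮ.starProjection k = 0 :=
          (Submodule.starProjection_apply_eq_zero_iff _).2 (K.le_orthogonal_orthogonal hk)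
        simp [this]
      have hyk : y.toOperator k = 0 := by
        have := hyle k
        rw [hzk, norm_zero] at this
        exact norm_eq_zero.1 (le_antisymm this (norm_nonneg _))
      change inner ℂ k (y.toOperator w) = 0
      rw [← ContinuousLinearMap.adjoint_inner_left, y.isSelfAdjoint.adjoint_eq, hyk,
        inner_zero_left]
    · have h1 := (mem_and_norm_le_of_singularValue_le z zero_le_one (z := y.toOperator) fun n => by
        rw [one_mul]
        exact singularValue_le_of_norm_apply_le hyle n).2
      rw [one_mul] at h1
      exact h1.trans ((norm_conj_starProjection_le _ x).trans hx1)
    · have h1 : h (z - y) ≤ ε / 2 := by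
        refine (le_abs_self _).trans ((h.le_opNorm _).trans ?_)
        have h2 : ε / (2 * (‖h‖ + 1)) * (‖h‖ + 1) = ε / 2 := by field_simp
        nlinarith [norm_nonneg h, norm_nonneg (z - y)]
      rw [map_sub] at h1
      linarith
  choose m u l y hu huK hl hyd hhy using hstep
  let next : {K : Submodule ℂ H // FiniteDimensional ℂ K} →
      {K : Submodule ℂ H // FiniteDimensional ℂ K} := fun K =>
    ⟨K.1 ⊔ Submodule.span ℂ (Set.range (u K)), by
      have := K.2
      have := FiniteDimensional.span_of_finite ℂ (Set.finite_range (u K))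
      infer_instance⟩
  let K : ℕ → {K : Submodule ℂ H // FiniteDimensional ℂ K} := fun n =>
    Nat.rec ⟨⊥, inferInstance⟩ (fun _ K => next K) n
  have hKmono : Monotone fun n => (K n).1 := monotone_nat_of_le_succ fun n => le_sup_left
  have huKs : ∀ n i, u (K n) i ∈ (K (n + 1)).1 := fun n i =>
    Submodule.mem_sup_right (Submodule.subset_span ⟨i, rfl⟩)
  have horth : ∀ n n' i i', n < n' → inner ℂ (u (K n) i) (u (K n') i') = 0 := fun n n' i i' hn =>
    huK (K n') i' _ (hKmono (show n + 1 ≤ n' from hn) (huKs n i))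
  refine hE (containsEllOne_of_orthogonal_sequence h (half_pos hε) (fun n => m (K n))
    (fun i => u (K i.1) i.2) ⟨fun i => (hu _).1 _, ?_⟩ (fun n => l (K n)) (fun n => hl (K n))
    (fun n => y (K n)) (fun n => hyd (K n)) fun n => hhy (K n))
  rintro ⟨n, i⟩ ⟨n', i'⟩ hne
  rcases lt_trichotomy n n' with hn | rfl | hn
  · exact horth _ _ _ _ hn
  · exact (hu (K n)).2 fun hi => hne (congrArg (Sigma.mk n) hi)
  · exact inner_eq_zero_symm.1 (horth _ _ _ _ hn)

/-- The Cauchy–Schwarz inequality for the off-diagonal part of a positive functional, in additive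
form: apply the functional to `(tp ± t⁻¹e) y (tp ± t⁻¹e) ≥ 0`. -/
theorem abs_sub_conj_le {g : SchattenSpace E H →L[ℝ] ℝ}
    (hg : ∀ x : SchattenSpace E H, x.toOperator.IsPositive → 0 ≤ g x) (K : Submodule ℂ H)
    [K.HasOrthogonalProjection] {y : SchattenSpace E H} (hy : y.toOperator.IsPositive) {t : ℝ}
    (ht : 0 < t) :
    |g y - g (conj K.starProjection y)| ≤ t ^ 2 * g (conj K.starProjection y) +
      (1 + t⁻¹ ^ 2) * g (conj Kᗮ.starProjection y) := by
  set p := K.starProjection with hp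
  set e := Kᗮ.starProjection with he
  have hpa : ContinuousLinearMap.adjoint p = p := (isSelfAdjoint_starProjection K).adjoint_eq
  have hea : ContinuousLinearMap.adjoint e = e := (isSelfAdjoint_starProjection Kᗮ).adjoint_eq
  have hpe : ∀ v, p v + e v = v := fun v => K.starProjection_add_starProjection_orthogonal v
  have key : ∀ s : ℝ, s ^ 2 = 1 → conj ((t : ℂ) • p + ((s * t⁻¹ : ℝ) : ℂ) • e) y =
      t ^ 2 • conj p y + t⁻¹ ^ 2 • conj e y + s • (y - conj p y - conj e y) := by
    intro s hs
    apply ext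
    simp only [toOperator_add, toOperator_sub, toOperator_smul, toOperator_conj, map_add,
      LinearIsometryEquiv.map_smulₛₗ, hpa, hea, Complex.conj_ofReal]
    ext v
    simp only [ContinuousLinearMap.comp_apply, _root_.add_apply, _root_.sub_apply,
      _root_.smul_apply, map_add, map_smul, ← Complex.coe_smul (_ : ℝ)]
    have h1 : y.toOperator v = p (y.toOperator (p v)) + e (y.toOperator (p v)) +
        (p (y.toOperator (e v)) + e (y.toOperator (e v))) := by
      rw [hpe, hpe, ← map_add, hpe]
    rw [h1]
    have ht' : (t : ℂ) * (t : ℂ)⁻¹ = 1 := mul_inv_cancel₀ (by exact_mod_cast ht.ne')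
    have hs' : (s : ℂ) ^ 2 = 1 := by exact_mod_cast hs
    push_cast
    match_scalars
    · ring
    · linear_combination (s : ℂ) * ht'
    · linear_combination (s : ℂ) * ht'
    · linear_combination ((t : ℂ)⁻¹) ^ 2 * hs'
  have hbound : ∀ s : ℝ, s ^ 2 = 1 → 0 ≤ t ^ 2 * g (conj p y) + t⁻¹ ^ 2 * g (conj e y) +
      s * (g y - g (conj p y) - g (conj e y)) := by
    intro s hs
    have := hg _ (conj_isPositive ((t : ℂ) • p + ((s * t⁻¹ : ℝ) : ℂ) • e) hy)
    rw [key s hs] at this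
    simpa using this
  have h1 := hbound 1 (by norm_num)
  have h2 := hbound (-1) (by norm_num)
  have h3 := hg _ (conj_isPositive e hy)
  rw [abs_le]
  constructor <;> linarith

/-- Compressions to finite-dimensional subspaces have finite-dimensional range. -/
theorem finiteDimensional_range_conj (K : Submodule ℂ H) [FiniteDimensional ℂ K] :
    FiniteDimensional ℝ
      (LinearMap.range (conj K.starProjection : SchattenSpace E H →L[ℝ] _).toLinearMap) := by
  have : FiniteDimensional ℝ (K →ₗ[ℂ] K) := FiniteDimensional.complexToReal _
  let Φ : LinearMap.range (conj K.starProjection : SchattenSpace E H →L[ℝ] _).toLinearMap →ₗ[ℝ]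
      (K →ₗ[ℂ] K) :=
    { toFun := fun x => compression x.1.toOperator K
      map_add' := fun x y => by
        ext u
        simp [compression, toOperator_add]
      map_smul' := fun c x => by
        ext u
        simp [compression, toOperator_smul] }
  refine FiniteDimensional.of_injective Φ ((injective_iff_map_eq_zero Φ).2 ?_)
  rintro ⟨_, x, rfl⟩ h0
  refine Subtype.ext (SchattenSpace.ext (ContinuousLinearMap.ext fun v => ?_))
  have h1 := congrArg Subtype.val (LinearMap.congr_fun h0
    ⟨K.starProjection v, K.starProjection_apply_mem v⟩)
  have hpp : ∀ w, K.starProjection (K.starProjection w) = K.starProjection w := fun w =>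
    Submodule.starProjection_eq_self_iff.2 (K.starProjection_apply_mem w)
  have hpa : ContinuousLinearMap.adjoint K.starProjection = K.starProjection :=
    (isSelfAdjoint_starProjection K).adjoint_eq
  change K.starProjection ((conj K.starProjection x).toOperator (K.starProjection v)) = 0 at h1
  change (conj K.starProjection x).toOperator v = 0
  rw [toOperator_conj, hpa] at h1 ⊢
  simpa only [ContinuousLinearMap.comp_apply, hpp] using h1

end SchattenSpace

/-! ### Positive functionals on normal ordered spaces -/

section normal

variable {Z : Type*} [NormedAddCommGroup Z] [NormedSpace ℝ Z] [PartialOrder Z]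
  [IsOrderedAddMonoid Z] [PosSMulMono ℝ Z]

/-- In the dual of a normal ordered space every functional is dominated by a positive one of
comparable norm. The positive functional comes from the Hahn–Banach theorem, applied to the
sublinear functional `z ↦ inf {N‖f‖‖a‖ - f w₂ | z = a - w₁ - w₂, w₁ ≥ 0, w₂ ≥ 0}`. -/
theorem exists_nonneg_dual_ge {N : ℝ}
    (hN : ∀ a z b : Z, a ≤ z → z ≤ b → ‖z‖ ≤ N * (‖a‖ + ‖b‖)) (f : Z →L[ℝ] ℝ) :
    ∃ g : Z →L[ℝ] ℝ, (∀ z, 0 ≤ z → 0 ≤ g z) ∧ (∀ z, 0 ≤ z → f z ≤ g z) ∧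
      ‖g‖ ≤ |N| * ‖f‖ := by
  set C := |N| * ‖f‖ with hC
  have hC0 : 0 ≤ C := by positivity
  let A : Z → Set ℝ := fun z =>
    {r | ∃ a w₁ w₂ : Z, 0 ≤ w₁ ∧ 0 ≤ w₂ ∧ z = a - w₁ - w₂ ∧ r = C * ‖a‖ - f w₂}
  have hlow : ∀ z, ∀ r ∈ A z, -(C * ‖z‖) ≤ r := by
    rintro z _ ⟨a, w₁, w₂, h1, h2, hz, rfl⟩
    have h3 : w₂ ≤ a - z := by
      rw [hz, sub_sub, sub_sub_cancel]
      exact le_add_of_nonneg_left h1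
    have h4 : ‖w₂‖ ≤ |N| * (‖a‖ + ‖z‖) := by
      refine (hN 0 w₂ (a - z) h2 h3).trans ?_
      rw [norm_zero, zero_add]
      gcongr
      · exact le_abs_self N
      · exact norm_sub_le a z
    have h5 : f w₂ ≤ ‖f‖ * (|N| * (‖a‖ + ‖z‖)) :=
      (le_abs_self _).trans ((f.le_opNorm w₂).trans (by gcongr))
    have h6 : ‖f‖ * (|N| * (‖a‖ + ‖z‖)) = C * ‖a‖ + C * ‖z‖ := by rw [hC]; ring
    linarith
  have hbdd : ∀ z, BddBelow (A z) := fun z => ⟨_, hlow z⟩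
  have hne : ∀ z, (A z).Nonempty := fun z => ⟨_, z, 0, 0, le_rfl, le_rfl, by simp, rfl⟩
  let p : Z → ℝ := fun z => sInf (A z)
  have hp_le : ∀ {z r}, r ∈ A z → p z ≤ r := fun {z r} hr => csInf_le (hbdd z) hr
  have hsmul : ∀ c : ℝ, 0 < c → ∀ z, p (c • z) ≤ c * p z := by
    intro c hc z
    rw [← div_le_iff₀' hc]
    refine le_csInf (hne z) ?_
    rintro _ ⟨a, w₁, w₂, h1, h2, hz, rfl⟩
    rw [div_le_iff₀' hc]
    refine hp_le ⟨c • a, c • w₁, c • w₂, smul_nonneg hc.le h1, smul_nonneg hc.le h2, ?_, ?_⟩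
    · rw [hz, smul_sub, smul_sub]
    · rw [norm_smul, map_smul, Real.norm_eq_abs, abs_of_pos hc, smul_eq_mul]
      ring
  obtain ⟨g, -, hg⟩ := exists_extension_of_le_sublinear (⊥ : Z →ₗ.[ℝ] ℝ) p
    (fun c hc z => le_antisymm (hsmul c hc z) (by
      have := hsmul c⁻¹ (inv_pos.2 hc) (c • z)
      rwa [inv_smul_smul₀ hc.ne', ← div_eq_inv_mul, le_div_iff₀' hc] at this))
    (fun z z' => by
      refine le_of_forall_pos_le_add fun ε hε => ?_
      obtain ⟨_, ⟨a, w₁, w₂, h1, h2, hz, rfl⟩, hr⟩ := exists_lt_of_csInf_lt (hne z)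
        (show sInf (A z) < p z + ε / 2 from lt_add_of_pos_right _ (half_pos hε))
      obtain ⟨_, ⟨a', w₁', w₂', h1', h2', hz', rfl⟩, hr'⟩ := exists_lt_of_csInf_lt (hne z')
        (show sInf (A z') < p z' + ε / 2 from lt_add_of_pos_right _ (half_pos hε))
      have h3 := hp_le (z := z + z') ⟨a + a', w₁ + w₁', w₂ + w₂', add_nonneg h1 h1',
        add_nonneg h2 h2', by rw [hz, hz']; abel, rfl⟩
      have h4 : C * ‖a + a'‖ ≤ C * (‖a‖ + ‖a'‖) := by
        gcongr
        exact norm_add_le _ _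
      rw [map_add] at h3
      linarith)
    (fun x => by
      have hx : (x : Z) = 0 := (Submodule.mem_bot ℝ).1 x.2
      have h0 : (⊥ : Z →ₗ.[ℝ] ℝ) x = 0 := by
        have : x = 0 := Subtype.ext hx
        rw [this, LinearPMap.map_zero]
      rw [h0, hx]
      refine le_csInf (hne 0) fun r hr => ?_
      simpa using hlow 0 r hr)
  have hgC : ∀ z, g z ≤ C * ‖z‖ := fun z =>
    (hg z).trans (hp_le ⟨z, 0, 0, le_rfl, le_rfl, by simp, by simp⟩)
  refine ⟨g.mkContinuous C fun z => abs_le.2 ⟨?_, hgC z⟩, fun z hz => ?_, fun z hz => ?_,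
    LinearMap.mkContinuous_norm_le _ hC0 _⟩
  · have := hgC (-z)
    rw [map_neg, norm_neg] at this
    linarith
  · have := (hg (-z)).trans (hp_le ⟨0, z, 0, hz, le_rfl, by simp, rfl⟩)
    rw [map_neg, norm_zero, map_zero] at this
    change 0 ≤ g z
    linarith
  · have := (hg (-z)).trans (hp_le ⟨0, 0, z, le_rfl, hz, by simp, rfl⟩)
    rw [map_neg, norm_zero] at this
    change f z ≤ g z
    linarith

end normal

/-! ### Compactness of dominated adjoints -/

theorem isCompactOperator_precomp_of_finiteDimensional_range {X Y Z : Type*}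
    [NormedAddCommGroup X] [NormedSpace ℝ X] [NormedAddCommGroup Y] [NormedSpace ℝ Y]
    [NormedAddCommGroup Z] [NormedSpace ℝ Z] (T : Y →L[ℝ] Z) (P : X →L[ℝ] Y)
    (hP : FiniteDimensional ℝ (LinearMap.range P.toLinearMap)) :
    IsCompactOperator (ContinuousLinearMap.precomp ℝ (T.comp P) :
      (Z →L[ℝ] ℝ) →L[ℝ] (X →L[ℝ] ℝ)) := by
  set V := LinearMap.range P.toLinearMap with hV
  let P' : X →L[ℝ] V := P.codRestrict V fun x => ⟨x, rfl⟩
  have : FiniteDimensional ℝ (V →L[ℝ] ℝ) := inferInstance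
  have : ProperSpace (V →L[ℝ] ℝ) := FiniteDimensional.proper ℝ (V →L[ℝ] ℝ)
  have h1 : IsCompactOperator (ContinuousLinearMap.precomp ℝ P' :
      (V →L[ℝ] ℝ) →L[ℝ] (X →L[ℝ] ℝ)) :=
    by
    have : LocallyCompactSpace (V →L[ℝ] ℝ) := locallyCompact_of_proper (α := V →L[ℝ] ℝ)
    exact isCompactOperator_of_locallyCompactSpace_rng (ContinuousLinearMap.precomp ℝ P')
  exact h1.comp_clm (ContinuousLinearMap.precomp ℝ (T.comp V.subtypeL) :
    (Z →L[ℝ] ℝ) →L[ℝ] (V →L[ℝ] ℝ))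

section domination

variable {E : SymmetricSequenceSpace} [TopologicalSpace.SeparableSpace E.Space]
  {H : Type*} [NormedAddCommGroup H] [InnerProductSpace ℂ H] [CompleteSpace H]
  {Z : Type*} [NormedAddCommGroup Z] [NormedSpace ℝ Z] [PartialOrder Z]

open SchattenSpace

/-- Compactness of `S*` makes the tails of the functionals `f ∘ S`, for positive `f` in the unit
ball, uniformly small. -/
theorem exists_forall_comp_conj_orthogonal_le (hE : ¬ E.ContainsEllOne)
    {S : SchattenSpace E H →L[ℝ] Z}
    (hS : IsCompactOperator (ContinuousLinearMap.precomp ℝ S :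
      (Z →L[ℝ] ℝ) →L[ℝ] (SchattenSpace E H →L[ℝ] ℝ))) {η : ℝ} (hη : 0 < η) :
    ∃ K : Submodule ℂ H, FiniteDimensional ℂ K ∧ ∀ f : Z →L[ℝ] ℝ, ‖f‖ ≤ 1 →
      (∀ z, 0 ≤ z → 0 ≤ f z) → ∀ y : SchattenSpace E H, y.toOperator.IsPositive → ‖y‖ ≤ 1 →
        f (S (conj Kᗮ.starProjection y)) ≤ 2 * η := by
  classical
  have htb := (hS.isCompact_closure_image_closedBall (f := (ContinuousLinearMap.precomp ℝ S :
      (Z →L[ℝ] ℝ) →L[ℝ] (SchattenSpace E H →L[ℝ] ℝ)).toLinearMap) 1).totallyBounded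
  obtain ⟨t, -, htfin, hcov⟩ := totallyBounded_iff_subset.1 htb _ (Metric.dist_mem_uniformity hη)
  choose K hK hKη using fun h : SchattenSpace E H →L[ℝ] ℝ =>
    exists_forall_conj_orthogonal_le hE h hη
  have hKfin : FiniteDimensional ℂ (htfin.toFinset.sup K : Submodule ℂ H) :=
    Submodule.finiteDimensional_finset_sup _ _
  refine ⟨htfin.toFinset.sup K, hKfin, fun f hf hfpos y hy hy1 => ?_⟩
  set L := htfin.toFinset.sup K with hL
  have hmem : f.comp S ∈ closure ((ContinuousLinearMap.precomp ℝ S :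
      (Z →L[ℝ] ℝ) →L[ℝ] (SchattenSpace E H →L[ℝ] ℝ)).toLinearMap '' Metric.closedBall 0 1) :=
    subset_closure ⟨f, by simpa using hf, rfl⟩
  obtain ⟨h, hht, hdist⟩ := mem_iUnion₂.1 (hcov hmem)
  have hdist' : ‖f.comp S - h‖ < η := by rwa [← dist_eq_norm]
  have hle : Lᗮ ≤ (K h)ᗮ := Submodule.orthogonal_le (Finset.le_sup (by simpa using hht))
  have hfix : conj Lᗮ.starProjection y =
      conj (K h)ᗮ.starProjection (conj Lᗮ.starProjection y) := by
    rw [conj_conj, Submodule.starProjection_comp_starProjection_of_le hle]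
  have hn : ‖conj Lᗮ.starProjection y‖ ≤ 1 := (norm_conj_starProjection_le _ y).trans hy1
  have h1 : h (conj Lᗮ.starProjection y) ≤ η := by
    rw [hfix]
    exact hKη h _ (conj_isPositive _ hy) hn
  have h2 : (f.comp S - h) (conj Lᗮ.starProjection y) ≤ η := by
    refine (le_abs_self _).trans (((f.comp S - h).le_opNorm (conj Lᗮ.starProjection y)).trans ?_)
    nlinarith [norm_nonneg (f.comp S - h)]
  have h3 : (f.comp S - h) (conj Lᗮ.starProjection y) =
      f (S (conj Lᗮ.starProjection y)) - h (conj Lᗮ.starProjection y) := rfl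
  linarith

theorem isCompactOperator_precomp_of_isDominatedBy [IsOrderedAddMonoid Z]
    [PosSMulMono ℝ Z] (hE : ¬ E.ContainsEllOne)
    (hZ : IsNormalOrdered Z) {T S : SchattenSpace E H →L[ℝ] Z} (hTS : IsDominatedBy T S)
    (hS : IsCompactOperator (ContinuousLinearMap.precomp ℝ S :
      (Z →L[ℝ] ℝ) →L[ℝ] (SchattenSpace E H →L[ℝ] ℝ))) :
    IsCompactOperator (ContinuousLinearMap.precomp ℝ T :
      (Z →L[ℝ] ℝ) →L[ℝ] (SchattenSpace E H →L[ℝ] ℝ)) := by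
  obtain ⟨N, hN⟩ := hZ
  have key : ∀ ε > 0, ∃ K : Submodule ℂ H, ∃ _ : FiniteDimensional ℂ K, ∀ f : Z →L[ℝ] ℝ,
      (∀ z, 0 ≤ z → 0 ≤ f z) →
        ‖f.comp T - (f.comp T).comp (conj K.starProjection)‖ ≤ ε * ‖f‖ := by
    intro ε hε
    -- `t` makes the corner `p · p` contribute at most `ε / 4`, then `η` does so for `e · e`
    set t := √(ε / (4 * (‖T‖ + 1))) with ht
    have ht0 : 0 < t := Real.sqrt_pos.2 (by positivity)
    have ht2 : t ^ 2 * (‖T‖ + 1) = ε / 4 := by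
      rw [ht, Real.sq_sqrt (by positivity)]
      field_simp
    set η := ε / (8 * (1 + t⁻¹ ^ 2)) with hη
    have hη0 : 0 < η := by positivity
    have hηt : (1 + t⁻¹ ^ 2) * (2 * η) = ε / 4 := by
      rw [hη]
      field_simp
      ring
    obtain ⟨K, hK, hKη⟩ := exists_forall_comp_conj_orthogonal_le hE hS hη0
    refine ⟨K, hK, fun f hfpos => ?_⟩
    have hunit : ∀ f : Z →L[ℝ] ℝ, ‖f‖ ≤ 1 → (∀ z, 0 ≤ z → 0 ≤ f z) →
        ‖f.comp T - (f.comp T).comp (conj K.starProjection)‖ ≤ ε := by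
      intro f hf1 hfpos
      have hgpos : ∀ x : SchattenSpace E H, x.toOperator.IsPositive → 0 ≤ (f.comp T) x :=
        fun x hx => hfpos _ (hTS x hx).1
      have hcone : ∀ y : SchattenSpace E H, y.toOperator.IsPositive → ‖y‖ ≤ 1 →
          |f (T y) - f (T (conj K.starProjection y))| ≤ ε / 2 := by
        intro y hy hy1
        refine (abs_sub_conj_le hgpos K hy ht0).trans ?_
        have h1 : (f.comp T) (conj K.starProjection y) ≤ ‖T‖ + 1 := by
          have h1 := (le_abs_self _).trans (f.le_opNorm (T (conj K.starProjection y)))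
          have h2 := (T.le_opNorm (conj K.starProjection y)).trans
            (mul_le_mul_of_nonneg_left ((norm_conj_starProjection_le K y).trans hy1)
              (norm_nonneg T))
          change f (T (conj K.starProjection y)) ≤ _
          nlinarith [norm_nonneg f, norm_nonneg T, norm_nonneg (T (conj K.starProjection y))]
        have h2 : (f.comp T) (conj Kᗮ.starProjection y) ≤ 2 * η := by
          have hp := conj_isPositive (Kᗮ.starProjection) hy
          refine le_trans ?_ (hKη f hf1 hfpos y hy hy1)
          have := hfpos _ (sub_nonneg.2 (hTS _ hp).2)
          rw [map_sub] at this
          exact sub_nonneg.1 this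
        have h3 : t ^ 2 * (f.comp T) (conj K.starProjection y) ≤ t ^ 2 * (‖T‖ + 1) := by gcongr
        have h4 : (1 + t⁻¹ ^ 2) * (f.comp T) (conj Kᗮ.starProjection y) ≤
            (1 + t⁻¹ ^ 2) * (2 * η) := by gcongr
        linarith
      refine ContinuousLinearMap.opNorm_le_of_unit_norm hε.le fun x hx => ?_
      obtain ⟨y, z, hy, hz, hyx, hzx, rfl⟩ := exists_sub_of_isPositive x
      have h1 := hcone y hy (hyx.trans hx.le)
      have h2 := hcone z hz (hzx.trans hx.le)
      have h3 : (f.comp T - (f.comp T).comp (conj K.starProjection)) (y - z) =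
          (f (T y) - f (T (conj K.starProjection y))) -
            (f (T z) - f (T (conj K.starProjection z))) := by
        simp only [_root_.sub_apply, ContinuousLinearMap.comp_apply, map_sub]
      rw [h3, Real.norm_eq_abs]
      exact (abs_sub _ _).trans (by linarith)
    rcases eq_or_ne f 0 with rfl | hf0
    · simp
    have hfn : 0 < ‖f‖ := norm_pos_iff.2 hf0
    have h1 := hunit (‖f‖⁻¹ • f) (by rw [norm_smul, norm_inv, norm_norm, inv_mul_cancel₀ hfn.ne'])
      fun z hz => mul_nonneg (inv_nonneg.2 hfn.le) (hfpos z hz)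
    have h2 : (‖f‖⁻¹ • f).comp T - ((‖f‖⁻¹ • f).comp T).comp (conj K.starProjection) =
        ‖f‖⁻¹ • (f.comp T - (f.comp T).comp (conj K.starProjection)) := by
      ext x
      simp [mul_sub]
    rw [h2, norm_smul,
      norm_inv, norm_norm, ← div_eq_inv_mul, div_le_iff₀ hfn] at h1
    exact h1
  have hclosed : IsClosed {A : (Z →L[ℝ] ℝ) →L[ℝ] (SchattenSpace E H →L[ℝ] ℝ) |
      IsCompactOperator A} := isClosed_setOfPred_isCompactOperator
  refine hclosed.closure_subset ((Metric.mem_closure_iff (α :=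
    (Z →L[ℝ] ℝ) →L[ℝ] (SchattenSpace E H →L[ℝ] ℝ))).2 fun ε hε => ?_)
  obtain ⟨K, hK, hKε⟩ := key (ε / (2 * (2 * |N| + 2))) (by positivity)
  refine ⟨ContinuousLinearMap.precomp ℝ (T.comp (conj K.starProjection)),
    isCompactOperator_precomp_of_finiteDimensional_range T _ (finiteDimensional_range_conj K), ?_⟩
  refine (dist_eq_norm (E := (Z →L[ℝ] ℝ) →L[ℝ] (SchattenSpace E H →L[ℝ] ℝ)) _ _).trans_lt ?_
  refine lt_of_le_of_lt (ContinuousLinearMap.opNorm_le_bound _ (half_pos hε).le fun f => ?_)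
    (half_lt_self hε)
  obtain ⟨g, hg0, hgf, hgn⟩ := exists_nonneg_dual_ge hN f
  have h1 := hKε g hg0
  have h2 := hKε (g - f) fun z hz => sub_nonneg.2 (hgf z hz)
  have h3 : ‖g - f‖ ≤ (|N| + 1) * ‖f‖ := (norm_sub_le _ _).trans (by linarith)
  have h4 : (ContinuousLinearMap.precomp ℝ T - ContinuousLinearMap.precomp ℝ
      (T.comp (conj K.starProjection)) : (Z →L[ℝ] ℝ) →L[ℝ] (SchattenSpace E H →L[ℝ] ℝ)) f =
      (g.comp T - (g.comp T).comp (conj K.starProjection)) -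
        ((g - f).comp T - ((g - f).comp T).comp (conj K.starProjection)) := by
    ext x
    simp only [ContinuousLinearMap.precomp_apply, _root_.sub_apply,
      ContinuousLinearMap.comp_apply]
    ring
  rw [h4]
  refine (norm_sub_le _ _).trans ((add_le_add h1 h2).trans ?_)
  rw [← mul_add]
  calc _ ≤ ε / (2 * (2 * |N| + 2)) * ((2 * |N| + 2) * ‖f‖) := by
        gcongr
        linarith [norm_nonneg f]
    _ = ε / 2 * ‖f‖ := by field_simp

end domination

/-! ### Banach lattices with compact order intervals -/

/-- In a Boolean algebra with a finitely additive measure in which every element can be halved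
approximately, finitely many elements can be halved approximately by a single element. -/
theorem exists_halving_finset {B : Type*} [BooleanAlgebra B] {f : B → ℝ}
    (hadd : ∀ a b, Disjoint a b → f (a ⊔ b) = f a + f b)
    (hhalf : ∀ w, ∃ c ≤ w, f w / 3 ≤ f c ∧ f c ≤ 2 / 3 * f w) (s : Finset B) (w : B) :
    ∃ c ≤ w, (f w / 3 ≤ f c ∧ f c ≤ 2 / 3 * f w) ∧
      ∀ u ∈ s, f (w ⊓ u) / 3 ≤ f (c ⊓ u) ∧ f (c ⊓ u) ≤ 2 / 3 * f (w ⊓ u) := by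
  classical
  induction s using Finset.induction_on generalizing w with
  | empty =>
    obtain ⟨c, hc, h⟩ := hhalf w
    exact ⟨c, hc, h, by simp⟩
  | insert u s _ ih =>
    obtain ⟨c₁, hc₁, h₁, hs₁⟩ := ih (w ⊓ u)
    obtain ⟨c₂, hc₂, h₂, hs₂⟩ := ih (w \ u)
    have hsplit : ∀ a, f a = f (a ⊓ u) + f (a \ u) := fun a => by
      rw [← hadd _ _ disjoint_inf_sdiff, sup_inf_sdiff]
    have hdisj : Disjoint c₁ c₂ :=
      disjoint_inf_sdiff.mono hc₁ hc₂
    have hinf : ∀ a, f ((c₁ ⊔ c₂) ⊓ a) = f (c₁ ⊓ a) + f (c₂ ⊓ a) := fun a => by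
      rw [inf_sup_right, hadd _ _ (hdisj.mono inf_le_left inf_le_left)]
    have hw : ∀ a, f (w ⊓ a) = f (w ⊓ u ⊓ a) + f (w \ u ⊓ a) := fun a => by
      rw [← hadd _ _ (disjoint_inf_sdiff.mono inf_le_left inf_le_left), ← inf_sup_right,
        sup_inf_sdiff]
    refine ⟨c₁ ⊔ c₂, sup_le (hc₁.trans inf_le_left) (hc₂.trans sdiff_le), ?_, fun a ha => ?_⟩
    · rw [hadd _ _ hdisj, hsplit w]
      constructor <;> linarith [h₁.1, h₁.2, h₂.1, h₂.2]
    · rcases Finset.mem_insert.1 ha with rfl | ha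
      · have h3 : (c₁ ⊔ c₂) ⊓ a = c₁ := by
          rw [inf_sup_right, inf_eq_left.2 (hc₁.trans inf_le_right),
            (disjoint_sdiff_self_left.mono_left hc₂).eq_bot, sup_bot_eq]
        rw [h3]
        exact h₁
      · rw [hinf, hw]
        have := hs₁ a ha
        have := hs₂ a ha
        constructor <;> linarith

/-- A nonempty compact set has a minimal element for a closed partial order. -/
theorem IsCompact.exists_minimal_mem {α : Type*} [TopologicalSpace α] [PartialOrder α]
    [OrderClosedTopology α] {s : Set α} (hs : IsCompact s) (hne : s.Nonempty) :
    ∃ m, Minimal (· ∈ s) m := by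
  obtain ⟨x, hx⟩ := hne
  obtain ⟨m, -, hm⟩ := zorn_le_nonempty₀ (α := αᵒᵈ) (OrderDual.ofDual ⁻¹' s)
    (fun c hcs hc y hy => by
      have hnec : Nonempty c := ⟨⟨y, hy⟩⟩
      have hchain : IsChain (· ≤ ·) (OrderDual.toDual ⁻¹' c) := hc.symm
      obtain ⟨b, hb⟩ := hs.inter_iInter_nonempty (fun a : (OrderDual.toDual ⁻¹' c : Set α) =>
        Iic a.1) (fun a => isClosed_Iic) fun u => by
          rcases u.eq_empty_or_nonempty with rfl | hu
          · exact ⟨x, by simpa using hx⟩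
          · obtain ⟨a, ha, hmin⟩ := u.exists_minimal hu
            refine ⟨a.1, hcs a.2, mem_iInter₂.2 fun a' ha' => ?_⟩
            rcases hchain.total a.2 a'.2 with h | h
            · exact h
            · exact hmin ha' h
      exact ⟨OrderDual.toDual b, hb.1, fun z hz => mem_iInter.1 hb.2 ⟨z, hz⟩⟩)
    (OrderDual.toDual x) hx
  exact ⟨OrderDual.ofDual m, hm.1, fun y hy hym => hm.2 hy hym⟩

section lattice

variable {Z : Type*} [NormedAddCommGroup Z] [Lattice Z] [IsOrderedAddMonoid Z] [HasSolidNorm Z]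

theorem isOrderContinuousBanachLattice_of_isCompact_Icc
    (h : ∀ s : Z, 0 ≤ s → IsCompact (Icc 0 s)) : IsOrderContinuousBanachLattice Z := by
  rintro D ⟨d₀, hd₀⟩ hdir hglb ε hε
  by_contra! hcon
  have hnonneg : ∀ d ∈ D, 0 ≤ d := fun d hd => hglb.1 hd
  -- a cluster point of the net would be a lower bound of norm at least `ε`
  obtain ⟨b, hb⟩ := (h d₀ (hnonneg d₀ hd₀)).inter_iInter_nonempty
    (fun d : D => Iic d.1 ∩ {z | ε ≤ ‖z‖})
    (fun d => isClosed_Iic.inter (isClosed_le continuous_const continuous_norm)) fun u => by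
      classical
      obtain ⟨e, heD, hed, heu⟩ : ∃ e ∈ D, e ≤ d₀ ∧ ∀ d ∈ u, e ≤ d.1 := by
        induction u using Finset.induction_on with
        | empty => exact ⟨d₀, hd₀, le_rfl, by simp⟩
        | insert a u _ ih =>
          obtain ⟨e, heD, hed, heu⟩ := ih
          obtain ⟨e', he'D, h1, h2⟩ := hdir e heD a.1 a.2
          refine ⟨e', he'D, h1.trans hed, fun d hd => ?_⟩
          rcases Finset.mem_insert.1 hd with rfl | hd
          · exact h2
          · exact h1.trans (heu d hd)
      exact ⟨e, ⟨hnonneg e heD, hed⟩, mem_iInter₂.2 fun d hd => ⟨heu d hd, hcon e heD⟩⟩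
  have hb0 : b = 0 :=
    le_antisymm (hglb.2 fun d hd => (mem_iInter.1 hb.2 ⟨d, hd⟩).1) hb.1.1
  have := (mem_iInter.1 hb.2 ⟨d₀, hd₀⟩).2
  rw [hb0, mem_ofPred_eq, norm_zero] at this
  linarith

omit [HasSolidNorm Z] in
theorem inf_add_le_inf_add_inf {x a b : Z} (hx : 0 ≤ x) (ha : 0 ≤ a) (hb : 0 ≤ b) :
    x ⊓ (a + b) ≤ x ⊓ a + x ⊓ b := by
  rw [inf_add, add_inf, add_inf]
  refine le_inf (le_inf ?_ ?_) (le_inf ?_ inf_le_right)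
  · exact inf_le_left.trans (le_add_of_nonneg_right hx)
  · exact inf_le_left.trans (le_add_of_nonneg_right hb)
  · exact inf_le_left.trans (le_add_of_nonneg_left ha)

/-- The components of `z`: the elements `c` of `[0, z]` disjoint from `z - c`. -/
def components (z : Z) : Set Z := {c | (0 ≤ c ∧ c ≤ z) ∧ c ⊓ (z - c) = 0}

theorem isClosed_components (z : Z) : IsClosed (components z) :=
  isClosed_Icc.inter (isClosed_eq (by fun_prop) continuous_const)

omit [HasSolidNorm Z] in
theorem sub_mem_components {z c : Z} (hc : c ∈ components z) : z - c ∈ components z :=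
  ⟨⟨sub_nonneg.2 hc.1.2, sub_le_self z hc.1.1⟩, by rw [sub_sub_cancel, inf_comm]; exact hc.2⟩

omit [HasSolidNorm Z] in
theorem components_trans {z c d : Z} (hc : c ∈ components z) (hd : d ∈ components c) :
    d ∈ components z := by
  have hdz := hd.1.2.trans hc.1.2
  refine ⟨⟨hd.1.1, hdz⟩, le_antisymm ?_ (le_inf hd.1.1 (sub_nonneg.2 hdz))⟩
  have h1 : z - d = (z - c) + (c - d) := by abel
  rw [h1]
  refine (inf_add_le_inf_add_inf hd.1.1 (sub_nonneg.2 hc.1.2) (sub_nonneg.2 hd.1.2)).trans ?_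
  rw [hd.2, add_zero, ← hc.2]
  exact inf_le_inf_right _ hd.1.2

variable [NormedSpace ℝ Z]

omit [HasSolidNorm Z] in
/-- Extreme points of an order interval are components. -/
theorem mem_components_of_mem_extremePoints {z c : Z} (hc : c ∈ (Icc 0 z).extremePoints ℝ) :
    c ∈ components z := by
  obtain ⟨⟨h0, hz⟩, hext⟩ := mem_extremePoints.1 hc
  refine ⟨⟨h0, hz⟩, ?_⟩
  set w := c ⊓ (z - c) with hw
  have hw0 : 0 ≤ w := le_inf h0 (sub_nonneg.2 hz)
  have hwc : w ≤ c := inf_le_left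
  have hwz : w ≤ z - c := inf_le_right
  have h1 := (hext (c - w) ⟨sub_nonneg.2 hwc, (sub_le_self c hw0).trans hz⟩ (c + w)
    ⟨add_nonneg h0 hw0, by rw [add_comm]; exact le_sub_iff_add_le.1 hwz⟩
    ⟨1 / 2, 1 / 2, by norm_num, by norm_num, by norm_num, by module⟩).2
  simpa using h1

variable [PosSMulMono ℝ Z]

omit [HasSolidNorm Z] in
/-- If `[0, v]` is compact and `v` is not an atom, then by the Krein–Milman theorem `v` splits into
two nonzero components. -/
theorem exists_component_ne {v : Z} (hv : 0 < v) (hcomp : IsCompact (Icc 0 v))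
    (hatom : ¬ IsLatticeAtom v) : ∃ c ∈ components v, c ≠ 0 ∧ c ≠ v := by
  by_contra! hcon
  refine hatom ⟨hv, fun b hb0 hbv => ?_⟩
  have hclosed : IsClosed (Submodule.span ℝ {v} : Set Z) := Submodule.closed_of_finiteDimensional _
  have hsub : (Icc 0 v).extremePoints ℝ ⊆ (Submodule.span ℝ {v} : Set Z) := fun c hc => by
    by_cases h : c = 0
    · rw [h]; exact Submodule.zero_mem _
    · rw [hcon c (mem_components_of_mem_extremePoints hc) h]
      exact Submodule.mem_span_singleton_self v
  have hmem : b ∈ closure (convexHull ℝ ((Icc 0 v).extremePoints ℝ)) := by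
    rw [closure_convexHull_extremePoints hcomp (convex_Icc 0 v)]
    exact ⟨hb0, hbv⟩
  have := closure_minimal (convexHull_min hsub (Submodule.convex _)) hclosed hmem
  obtain ⟨t, ht⟩ := Submodule.mem_span_singleton.1 this
  exact ⟨t, ht.symm⟩

/-- Below an element without atoms, components can be halved approximately with respect to a
positive functional. The half is a minimal component that is not too small. -/
theorem exists_component_halving {z : Z} (hcomp : ∀ s : Z, 0 ≤ s → IsCompact (Icc 0 s))
    (hatom : ∀ a ≤ z, ¬ IsLatticeAtom a) {f : Z →L[ℝ] ℝ} (hf : ∀ x, 0 ≤ x → 0 ≤ f x) {w : Z}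
    (hw : w ∈ components z) :
    ∃ c ∈ components z, c ≤ w ∧ f w / 3 ≤ f c ∧ f c ≤ 2 / 3 * f w := by
  rcases (hf w hw.1.1).eq_or_lt with h0 | hpos
  · exact ⟨w, hw, le_rfl, by linarith, by linarith⟩
  set s : Set Z := {c | (c ∈ components z ∧ c ≤ w) ∧ f w / 3 ≤ f c} with hs
  have hsc : IsCompact s := by
    refine (hcomp w hw.1.1).of_isClosed_subset ?_ fun c hc => ⟨hc.1.1.1.1, hc.1.2⟩
    exact ((isClosed_components z).inter isClosed_Iic).inter
      (isClosed_le continuous_const f.continuous)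
  obtain ⟨v, ⟨⟨hvz, hvw⟩, hv3⟩, hmin⟩ := hsc.exists_minimal_mem
    ⟨w, ⟨hw, le_rfl⟩, by linarith⟩
  refine ⟨v, hvz, hvw, hv3, ?_⟩
  by_contra! hbig
  have hv0 : v ≠ 0 := fun h => by
    rw [h, map_zero] at hv3
    linarith
  have hvpos : 0 < v := lt_of_le_of_ne hvz.1.1 (Ne.symm hv0)
  obtain ⟨c, hc, hc0, hcv⟩ := exists_component_ne hvpos (hcomp v hvz.1.1) (hatom v hvz.1.2)
  have hsmall : ∀ d ∈ components v, d ≠ v → f d < f w / 3 := fun d hd hne => by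
    by_contra! hcon
    exact hne (le_antisymm hd.1.2
      (hmin ⟨⟨components_trans hvz hd, hd.1.2.trans hvw⟩, hcon⟩ hd.1.2))
  have h1 := hsmall c hc hcv
  have h2 := hsmall (v - c) (sub_mem_components hc) fun h => hc0 (sub_eq_self.1 h)
  rw [map_sub] at h2
  linarith

/-- A Banach lattice with compact order intervals is atomic. Otherwise some `z > 0` dominates no
atom, and by compactness a single component `c` of `z` halves all components of `z` approximately,
with respect to a positive functional; this is absurd for the components `c` and `z - c`. -/
theorem isAtomicBanachLattice_of_isCompact_Icc
    (h : ∀ s : Z, 0 ≤ s → IsCompact (Icc 0 s)) : IsAtomicBanachLattice Z := by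
  intro z hz
  by_contra! hcon
  have hatom : ∀ a ≤ z, ¬ IsLatticeAtom a := fun a ha hat => hcon a hat ha
  obtain ⟨φ, -, hφ⟩ := exists_dual_vector ℝ z (norm_ne_zero_iff.2 hz.ne')
  obtain ⟨f, hf, hfφ, -⟩ := exists_nonneg_dual_ge (N := 1) (fun a z b haz hzb => by
    rw [one_mul]
    refine (HasSolidNorm.solid (y := |a| + |b|) ?_).trans
      ((norm_add_le _ _).trans_eq (by rw [norm_abs_eq_norm, norm_abs_eq_norm]))
    rw [abs_of_nonneg (add_nonneg (abs_nonneg a) (abs_nonneg b))]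
    refine abs_le'.2 ⟨?_, ?_⟩
    · exact (hzb.trans (le_abs_self b)).trans (le_add_of_nonneg_left (abs_nonneg a))
    · exact ((neg_le_neg haz).trans (neg_le_abs a)).trans
        (le_add_of_nonneg_right (abs_nonneg b))) φ
  have hfz : 0 < f z := by
    refine lt_of_lt_of_le ?_ (hfφ z hz.le)
    rw [hφ]
    exact norm_pos_iff.2 hz.ne'
  have : Fact ((0 : Z) ≤ z) := ⟨hz.le⟩
  let : DistribLattice Z := AddCommGroup.toDistribLattice Z
  let : DistribLattice (Icc 0 z) :=
    { (inferInstance : Lattice (Icc 0 z)) with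
      le_sup_inf := fun a b c => (le_sup_inf : ((a : Z) ⊔ b) ⊓ (a ⊔ c) ≤ a ⊔ b ⊓ c) }
  let : BooleanAlgebra (Complementeds (Icc 0 z)) :=
    DistribLattice.booleanAlgebraOfComplemented _
  let toComp : components z → Complementeds (Icc 0 z) := fun c =>
    ⟨⟨c, c.2.1⟩, ⟨z - c, (sub_mem_components c.2).1⟩, Icc.isCompl_iff.2 ⟨c.2.2, by
      have := inf_add_sup c.1 (z - c)
      rw [c.2.2, zero_add, add_sub_cancel] at this
      exact this⟩⟩
  have hadd : ∀ {a b : Icc 0 z}, a ⊓ b = ⊥ → ((a ⊔ b : Icc 0 z) : Z) = a + b := by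
    intro a b hab
    have h1 : (a : Z) ⊓ b = 0 := congrArg Subtype.val hab
    have := inf_add_sup (a : Z) b
    rwa [h1, zero_add] at this
  have hmem : ∀ b : Complementeds (Icc 0 z), ((b : Icc 0 z) : Z) ∈ components z := by
    rintro ⟨b, d, hbd⟩
    have h1 := hadd hbd.inf_eq_bot
    rw [hbd.sup_eq_top] at h1
    have h2 : z - b = (d : Z) := by
      rw [sub_eq_iff_eq_add']
      exact h1
    exact ⟨b.2, by rw [h2]; exact congrArg Subtype.val hbd.inf_eq_bot⟩
  have hkey := exists_halving_finset (B := Complementeds (Icc 0 z))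
    (f := fun b => f ((b : Icc 0 z) : Z))
    (fun a b hab => by
      rw [← map_add, ← hadd]
      · rfl
      · exact congrArg Subtype.val hab.eq_bot)
    (fun w => by
      obtain ⟨c, hc, hcw, h1⟩ := exists_component_halving h hatom hf (hmem w)
      exact ⟨toComp ⟨c, hc⟩, hcw, h1⟩)
  obtain ⟨c, ⟨-, hc⟩, hct⟩ := ((h z hz.le).inter_right (isClosed_components z)).inter_iInter_nonempty
    (fun u : components z => {c : Z | f u / 3 ≤ f (c ⊓ u) ∧ f (c ⊓ u) ≤ 2 / 3 * f u})
    (fun u => (isClosed_le continuous_const (f.continuous.comp (by fun_prop))).inter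
      (isClosed_le (f.continuous.comp (by fun_prop)) continuous_const)) fun s => by
      classical
      obtain ⟨c, -, -, hc⟩ := hkey (s.image toComp) ⊤
      refine ⟨c, ⟨(hmem c).1, hmem c⟩, mem_iInter₂.2 fun u hu => ?_⟩
      have := hc _ (Finset.mem_image_of_mem _ hu)
      rw [top_inf_eq] at this
      exact this
  have h1 := (mem_iInter.1 hct ⟨c, hc⟩).2
  have h2 := (mem_iInter.1 hct ⟨z - c, sub_mem_components hc⟩).1
  simp only [inf_idem] at h1
  rw [hc.2, map_zero, map_sub] at h2
  linarith

end lattice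

/-! ### Functionals on spaces containing `ℓ₁` -/

namespace SymmetricSequenceSpace

variable (E : SymmetricSequenceSpace)

/-- The unit vectors of a symmetric sequence space. -/
def unitVec (k : ℕ) : E.Space := (⟨Pi.single k 1, E.single_mem k 1⟩ : E.carrier)

/-- The part of a sequence on the indices `≥ N`. -/
def tail (N : ℕ) (x : E.Space) : E.Space :=
  (⟨(Ici N).indicator x.1, (E.indicator_mem x.2 _).1⟩ : E.carrier)

theorem norm_tail_le (N : ℕ) (x : E.Space) : ‖E.tail N x‖ ≤ ‖x‖ := (E.indicator_mem x.2 _).2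

theorem sum_smul_unitVec_apply (N : ℕ) (c : ℕ → ℝ) (k : ℕ) :
    (∑ j ∈ Finset.range N, c j • E.unitVec j).1 k = if k < N then c k else 0 := by
  rw [← E.coord_apply, map_sum]
  have h : ∀ j, E.coord k (c j • E.unitVec j) = if k = j then c j else 0 := fun j => by
    rw [map_smul, E.coord_apply]
    change c j * (Pi.single j 1 : ℕ → ℝ) k = _
    rw [Pi.single_apply, mul_ite, mul_one, mul_zero]
  simp [h]

theorem eq_sum_add_tail (N : ℕ) (x : E.Space) :
    x = ∑ j ∈ Finset.range N, x.1 j • E.unitVec j + E.tail N x := by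
  refine Subtype.ext (funext fun k => ?_)
  change x.1 k = (∑ j ∈ Finset.range N, x.1 j • E.unitVec j).1 k + (Ici N).indicator x.1 k
  rw [sum_smul_unitVec_apply]
  by_cases h : k < N
  · simp [h]
  · simp [h, not_lt.1 h]

theorem sum_abs_mul_abs_le (φ : E.Space →L[ℝ] ℝ) (M : ℕ) {d : ℕ → ℝ}
    (hd : (Iio M).indicator d ∈ E.carrier) :
    ∑ k ∈ Finset.range M, |φ (E.unitVec k)| * |d k| ≤ ‖φ‖ * E.norm ((Iio M).indicator d) := by
  set c : ℕ → ℝ := fun k => SignType.sign (φ (E.unitVec k)) * |d k| with hc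
  set x : E.Space := ∑ k ∈ Finset.range M, c k • E.unitVec k with hx
  have h1 : φ x = ∑ k ∈ Finset.range M, |φ (E.unitVec k)| * |d k| := by
    rw [hx, map_sum]
    refine Finset.sum_congr rfl fun k _ => ?_
    rw [map_smul, smul_eq_mul, hc, ← sign_mul_self]
    ring
  have h2 : ‖x‖ ≤ E.norm ((Iio M).indicator d) := (E.mem_and_norm_le hd fun k => by
    rw [hx, sum_smul_unitVec_apply]
    by_cases h : k < M
    · rw [if_pos h, indicator_of_mem (mem_Iio.2 h), hc, abs_mul, abs_abs]
      refine mul_le_of_le_one_left (abs_nonneg _) ?_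
      rcases SignType.trichotomy (SignType.sign (φ (E.unitVec k))) with h | h | h <;> simp [h]
    · simp [h]).2
  rw [← h1]
  exact (le_abs_self _).trans ((φ.le_opNorm x).trans (by gcongr))

/-- If all functionals on `E` have norm-null tails, then the coordinate functionals span a dense
subspace of the dual, which is therefore separable. -/
theorem separableSpace_dual_of_tail (h : ∀ (φ : E.Space →L[ℝ] ℝ), ∀ ε > 0, ∃ N, ∀ x : E.Space,
    ‖x‖ ≤ 1 → (∀ k < N, x.1 k = 0) → φ x < ε) :
    TopologicalSpace.SeparableSpace (E.Space →L[ℝ] ℝ) := by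
  have hsep : TopologicalSpace.IsSeparable
      (Submodule.span ℝ (Set.range E.coord) : Set (E.Space →L[ℝ] ℝ)) :=
    (Set.countable_range E.coord).isSeparable.span
  have hdense : closure (Submodule.span ℝ (Set.range E.coord) : Set (E.Space →L[ℝ] ℝ)) = univ := by
    refine eq_univ_of_forall fun φ => (Metric.mem_closure_iff (α := E.Space →L[ℝ] ℝ)).2
      fun ε hε => ?_
    obtain ⟨N, hN⟩ := h φ (ε / 2) (half_pos hε)
    refine ⟨∑ k ∈ Finset.range N, φ (E.unitVec k) • E.coord k,
      Submodule.sum_mem _ fun k _ => Submodule.smul_mem _ _ (Submodule.subset_span ⟨k, rfl⟩), ?_⟩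
    refine (dist_eq_norm (E := E.Space →L[ℝ] ℝ) _ _).trans_lt ?_
    refine (ContinuousLinearMap.opNorm_le_of_unit_norm (half_pos hε).le fun x hx => ?_).trans_lt
      (half_lt_self hε)
    have h1 : (φ - ∑ k ∈ Finset.range N, φ (E.unitVec k) • E.coord k) x = φ (E.tail N x) := by
      have := congrArg φ (E.eq_sum_add_tail N x)
      rw [map_add, map_sum] at this
      rw [_root_.sub_apply, _root_.sum_apply, this, sub_eq_iff_eq_add', add_left_inj]
      refine Finset.sum_congr rfl fun k _ => ?_
      rw [map_smul, _root_.smul_apply, smul_eq_mul, smul_eq_mul, mul_comm]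
      rfl
    have hzero : ∀ k < N, (E.tail N x).1 k = 0 := fun k hk =>
      indicator_of_notMem (by simpa using hk) _
    have hn : ‖E.tail N x‖ ≤ 1 := (E.norm_tail_le N x).trans hx.le
    rw [h1, Real.norm_eq_abs]
    refine abs_le'.2 ⟨(hN _ hn hzero).le, ?_⟩
    have := hN (-E.tail N x) (by rwa [_root_.norm_neg]) fun k hk => by
      change -((E.tail N x).1 k) = 0
      rw [hzero k hk, neg_zero]
    rw [map_neg] at this
    exact this.le
  have := hsep.closure
  rw [hdense] at this
  exact TopologicalSpace.isSeparable_univ_iff.1 this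

end SymmetricSequenceSpace

/-- The dual of a space containing `ℓ₁` is not separable: the functionals `a ↦ ∑_{n ∈ A} a n` on
`ℓ₁`, `A ⊆ ℕ`, extend to an uncountable separated family. -/
theorem not_separableSpace_dual_of_ellOne {X : Type*} [NormedAddCommGroup X] [NormedSpace ℝ X]
    (J : lp (fun _ : ℕ => ℝ) 1 →L[ℝ] X) {c : ℝ} (hc : 0 < c) (hJ : ∀ a, c * ‖a‖ ≤ ‖J a‖) :
    ¬ TopologicalSpace.SeparableSpace (X →L[ℝ] ℝ) := by
  classical
  intro hsep
  have hinj : Function.Injective J.toLinearMap := (injective_iff_map_eq_zero _).2 fun a ha => by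
    have h1 := hJ a
    have h2 : J a = 0 := ha
    rw [h2, norm_zero] at h1
    exact norm_eq_zero.1 (le_antisymm (by nlinarith [norm_nonneg a]) (norm_nonneg a))
  have hχ : ∀ (A : Set ℕ) n, ‖if n ∈ A then (1 : ℝ) else 0‖ ≤ 1 := fun A n => by
    split_ifs <;> simp
  let θ : Set ℕ → lp (fun _ : ℕ => ℝ) 1 →L[ℝ] ℝ := fun A => ellOneLift _ 1 (hχ A)
  have hθ : ∀ A n, θ A (lp.single 1 n (1 : ℝ)) = if n ∈ A then 1 else 0 := by
    intro A n
    refine (hasSum_ellOneLift (hχ A) (lp.single 1 n (1 : ℝ))).unique ?_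
    convert hasSum_single n ?_ using 1
    · simp
    · intro m hm
      simp [lp.single_apply, hm]
  have hext : ∀ A, ∃ Ψ : X →L[ℝ] ℝ, ∀ a, Ψ (J a) = θ A a := by
    intro A
    let e := LinearEquiv.ofInjective J.toLinearMap hinj
    let g : LinearMap.range J.toLinearMap →L[ℝ] ℝ :=
      ((θ A).toLinearMap ∘ₗ e.symm.toLinearMap).mkContinuous (‖θ A‖ / c) fun x => by
        obtain ⟨a, rfl⟩ := e.surjective x
        have h1 : ‖e a‖ = ‖J a‖ := rfl
        rw [LinearMap.comp_apply, LinearEquiv.coe_coe, LinearEquiv.symm_apply_apply, h1,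
          div_mul_eq_mul_div, le_div_iff₀ hc]
        have h2 := (θ A).le_opNorm a
        have h3 := mul_le_mul_of_nonneg_left (hJ a) (norm_nonneg (θ A))
        have h4 := mul_le_mul_of_nonneg_right h2 hc.le
        calc _ ≤ ‖θ A‖ * ‖a‖ * c := h4
          _ = ‖θ A‖ * (c * ‖a‖) := by ring
          _ ≤ _ := h3
    obtain ⟨Ψ, hΨ, -⟩ := exists_extension_norm_eq _ g
    refine ⟨Ψ, fun a => ?_⟩
    have h1 := hΨ (e a)
    have h2 : g (e a) = θ A a := by
      change θ A (e.symm (e a)) = _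
      rw [LinearEquiv.symm_apply_apply]
    rw [← h2, ← h1]
    rfl
  choose Ψ hΨ using hext
  set δ := 1 / (‖J‖ + 1) with hδ
  have hδ0 : 0 < δ := by positivity
  have hdist : ∀ A B : Set ℕ, A ≠ B → δ ≤ dist (Ψ A) (Ψ B) := by
    intro A B hAB
    obtain ⟨n, hn⟩ : ∃ n, ¬ (n ∈ A ↔ n ∈ B) := by
      by_contra! h
      exact hAB (Set.ext h)
    have hs : ‖lp.single (E := fun _ : ℕ => ℝ) 1 n (1 : ℝ)‖ = 1 := by
      rw [lp.norm_single (by simp)]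
      simp
    have h1 : ‖(Ψ A - Ψ B) (J (lp.single 1 n (1 : ℝ)))‖ = 1 := by
      rw [_root_.sub_apply, hΨ, hΨ, hθ, hθ]
      by_cases hA : n ∈ A <;> by_cases hB : n ∈ B <;> simp_all
    have h2 := (Ψ A - Ψ B).le_opNorm (J (lp.single 1 n (1 : ℝ)))
    have h3 := J.le_opNorm (lp.single 1 n (1 : ℝ))
    rw [hs, mul_one] at h3
    rw [h1] at h2
    have h5 : dist (Ψ A) (Ψ B) = ‖Ψ A - Ψ B‖ := dist_eq_norm (E := X →L[ℝ] ℝ) _ _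
    rw [h5, hδ, div_le_iff₀ (by positivity)]
    refine h2.trans ?_
    gcongr
    linarith
  have hcount : Countable (Set ℕ) := by
    refine Pairwise.countable_of_isOpen_disjoint
      (s := fun A => Metric.ball (α := X →L[ℝ] ℝ) (Ψ A) (δ / 2)) ?_
      (fun A => Metric.isOpen_ball) (fun A => ⟨Ψ A, Metric.mem_ball_self (by positivity)⟩)
    intro A A' hne
    exact Metric.ball_disjoint_ball (by linarith [hdist A A' hne])
  obtain ⟨g, hg⟩ := exists_surjective_nat (Set ℕ)
  exact Function.cantor_surjective g hg

namespace SymmetricSequenceSpace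

variable {E : SymmetricSequenceSpace}

theorem ContainsEllOne.exists_functional (h : E.ContainsEllOne) :
    ∃ (φ : E.Space →L[ℝ] ℝ) (ε : ℝ), 0 < ε ∧ ∀ N, ∃ x : E.Space, ‖x‖ ≤ 1 ∧
      (∀ k < N, x.1 k = 0) ∧ ε ≤ φ x := by
  obtain ⟨J, c, hc, hJ⟩ := h
  by_contra! hcon
  exact not_separableSpace_dual_of_ellOne J hc hJ (E.separableSpace_dual_of_tail hcon)

/-- If `E` contains `ℓ₁`, then there are a functional `φ`, successive blocks of indices and a
norm-bounded sequence in `E` such that `|φ|` takes the value `1` on the restriction of the `n`-th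
term to the `n`-th block. -/
theorem ContainsEllOne.exists_blocks [TopologicalSpace.SeparableSpace E.Space]
    (h : E.ContainsEllOne) :
    ∃ (φ : E.Space →L[ℝ] ℝ) (C : ℝ) (N : ℕ → ℕ) (b : ℕ → ℕ → ℝ), StrictMono N ∧
      (∀ n, b n ∈ E.carrier) ∧ (∀ n, E.norm (b n) ≤ C) ∧
      ∀ n, ∑ k ∈ Finset.Ico (N n) (N (n + 1)), |φ (E.unitVec k)| * b n k = 1 := by
  obtain ⟨φ, ε, hε, hφ⟩ := h.exists_functional
  have hstep : ∀ N, ∃ M > N, ∃ b ∈ E.carrier, E.norm b ≤ 2 / ε ∧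
      ∑ k ∈ Finset.Ico N M, |φ (E.unitVec k)| * b k = 1 := by
    intro N
    obtain ⟨x, hx1, hx0, hxε⟩ := hφ N
    obtain ⟨M₀, hM₀⟩ := E.exists_norm_tail_lt x.2 (show 0 < ε / (2 * (‖φ‖ + 1)) by positivity)
    set M := max M₀ (N + 1) with hM
    have htail : ‖E.tail M x‖ ≤ ε / (2 * (‖φ‖ + 1)) := by
      refine le_trans ?_ hM₀.le
      refine (E.mem_and_norm_le (E.indicator_mem x.2 _).1 fun k => ?_).2
      by_cases hk : k ∈ Ici M
      · have : k ∈ Ici M₀ := mem_Ici.2 ((le_max_left _ _).trans (mem_Ici.1 hk))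
        change |(Ici M).indicator x.1 k| ≤ _
        rw [indicator_of_mem hk, indicator_of_mem this]
      · change |(Ici M).indicator x.1 k| ≤ _
        rw [indicator_of_notMem hk, abs_zero]
        exact abs_nonneg _
    have hφtail : φ (E.tail M x) ≤ ε / 2 := by
      refine (le_abs_self _).trans ((φ.le_opNorm (E.tail M x)).trans ?_)
      have h2 : ε / (2 * (‖φ‖ + 1)) * (‖φ‖ + 1) = ε / 2 := by field_simp
      nlinarith [_root_.norm_nonneg φ, _root_.norm_nonneg (E.tail M x)]
    have hsum : φ x = ∑ k ∈ Finset.range M, x.1 k * φ (E.unitVec k) + φ (E.tail M x) := by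
      have := congrArg φ (E.eq_sum_add_tail M x)
      rw [map_add, map_sum] at this
      rw [this, add_left_inj]
      exact Finset.sum_congr rfl fun k _ => by rw [map_smul, smul_eq_mul]
    have hblock : ∑ k ∈ Finset.range M, x.1 k * φ (E.unitVec k) =
        ∑ k ∈ Finset.Ico N M, x.1 k * φ (E.unitVec k) := by
      rw [Finset.range_eq_Ico, ← Finset.sum_Ico_consecutive _ (Nat.zero_le N)
        (show N ≤ M from (Nat.le_succ N).trans (le_max_right _ _))]
      rw [Finset.sum_eq_zero fun k hk => ?_, zero_add]
      rw [hx0 k (Finset.mem_Ico.1 hk).2, zero_mul]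
    set σ := ∑ k ∈ Finset.Ico N M, |φ (E.unitVec k)| * |x.1 k| with hσ
    have hσε : ε / 2 ≤ σ := by
      have h1 : ∑ k ∈ Finset.Ico N M, x.1 k * φ (E.unitVec k) ≤ σ :=
        Finset.sum_le_sum fun k _ => by
          rw [mul_comm, ← abs_mul]
          exact le_abs_self _
      linarith
    have hσ0 : 0 < σ := (half_pos hε).trans_le hσε
    have habs := E.mem_and_norm_le (y := fun k => |x.1 k|) x.2 fun k => (abs_abs _).le
    refine ⟨M, (Nat.lt_succ_self N).trans_le (le_max_right _ _), σ⁻¹ • fun k => |x.1 k|,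
      E.carrier.smul_mem _ habs.1, ?_, ?_⟩
    · rw [E.norm_smul _ _ habs.1, abs_of_pos (inv_pos.2 hσ0)]
      have h1 : E.norm (fun k => |x.1 k|) ≤ 1 := habs.2.trans hx1
      have h2 : σ⁻¹ ≤ 2 / ε := by
        rw [inv_le_comm₀ hσ0 (by positivity), inv_div]
        exact hσε
      calc _ ≤ σ⁻¹ * 1 := by gcongr
        _ ≤ 2 / ε := by rwa [mul_one]
    · rw [← inv_mul_cancel₀ hσ0.ne', hσ, Finset.mul_sum]
      refine Finset.sum_congr rfl fun k _ => ?_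
      rw [Pi.smul_apply, smul_eq_mul]
      ring
  choose M hM b hbE hbn hb1 using hstep
  let N : ℕ → ℕ := fun n => Nat.rec 0 (fun _ a => M a) n
  exact ⟨φ, 2 / ε, N, fun n => b (N n), strictMono_nat_of_lt_succ fun n => hM (N n),
    fun n => hbE _, fun n => hbn _, fun n => hb1 _⟩

end SymmetricSequenceSpace

/-! ### Diagonals in an orthonormal sequence -/

theorem exists_orthonormal_nat {H : Type*} [NormedAddCommGroup H] [InnerProductSpace ℂ H]
    [CompleteSpace H] (hH : ¬ FiniteDimensional ℂ H) : ∃ v : ℕ → H, Orthonormal ℂ v := by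
  obtain ⟨w, b, hb⟩ := exists_hilbertBasis ℂ H
  have hinf : Infinite w := by
    by_contra hfin
    rw [not_infinite_iff_finite] at hfin
    have hfd : FiniteDimensional ℂ (Submodule.span ℂ (Set.range b)) :=
      FiniteDimensional.span_of_finite ℂ (Set.finite_range b)
    have h1 := b.dense_span
    rw [(Submodule.closed_of_finiteDimensional _).submodule_topologicalClosure_eq] at h1
    rw [h1] at hfd
    exact hH (Module.finite_def.2 (Module.Finite.iff_fg.1 hfd))
  exact ⟨_, b.orthonormal.comp _ (Infinite.natEmbedding w).injective⟩

namespace SchattenSpace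

variable {E : SymmetricSequenceSpace} {H : Type*} [NormedAddCommGroup H] [InnerProductSpace ℂ H]
  [CompleteSpace H] {v : ℕ → H}

/-- The diagonal of an operator in a sequence of vectors. -/
def diag (v : ℕ → H) (x : SchattenSpace E H) (k : ℕ) : ℝ :=
  (inner ℂ (x.toOperator (v k)) (v k)).re

theorem diag_nonneg {x : SchattenSpace E H} (hx : x.toOperator.IsPositive) (k : ℕ) :
    0 ≤ diag v x k := hx.re_inner_nonneg_left (v k)

theorem norm_indicator_diag_le (hv : Orthonormal ℂ v) (x : SchattenSpace E H) (M : ℕ) :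
    (Iio M).indicator (diag v x) ∈ E.carrier ∧ E.norm ((Iio M).indicator (diag v x)) ≤ ‖x‖ := by
  classical
  set s := Finset.range M with hs
  set K := Submodule.span ℂ (s.image v : Set H) with hK
  let e₀ : OrthonormalBasis s ℂ K := OrthonormalBasis.span hv s
  have he₀ : ∀ i, (e₀ i : H) = v i := OrthonormalBasis.span_apply hv s
  have : FiniteDimensional ℂ K := FiniteDimensional.span_finset ℂ _
  let σ : s ≃ Fin (Module.finrank ℂ K) :=
    Fintype.equivFinOfCardEq (Module.finrank_eq_card_basis e₀.toBasis).symm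
  let e := e₀.reindex σ
  have h1 := norm_padZero_diag_le K x.isSelfAdjoint E x.mem e
  have h2 := E.mem_and_norm_le_of_dom (y := (Iio M).indicator (diag v x))
    (padZero_mem E fun i => (inner ℂ (x.toOperator (e i)) (e i : H)).re)
    (fun j => if h : j < Module.finrank ℂ K then (σ.symm ⟨j, h⟩ : ℕ) else 0) fun k => by
      by_cases hk : k < M
      · refine Or.inr ⟨σ ⟨k, Finset.mem_range.2 hk⟩, by simp, ?_⟩
        rw [padZero_fin, indicator_of_mem (mem_Iio.2 hk)]
        simp [e, he₀, diag]
      · exact Or.inl (indicator_of_notMem (by simpa using hk) _)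
  exact ⟨h2.1, h2.2.trans h1⟩

theorem sum_abs_mul_abs_diag_le (hv : Orthonormal ℂ v) (φ : E.Space →L[ℝ] ℝ)
    (x : SchattenSpace E H) (M : ℕ) :
    ∑ k ∈ Finset.range M, |φ (E.unitVec k)| * |diag v x k| ≤ ‖φ‖ * ‖x‖ :=
  (E.sum_abs_mul_abs_le φ M (norm_indicator_diag_le hv x M).1).trans
    (mul_le_mul_of_nonneg_left (norm_indicator_diag_le hv x M).2 (norm_nonneg φ))

/-- The sum of the `|φ|`-weighted diagonal entries of `x` over one block of indices. -/
def blockSum (v : ℕ → H) (φ : E.Space →L[ℝ] ℝ) (N : ℕ → ℕ) (x : SchattenSpace E H) (n : ℕ) : ℝ :=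
  ∑ k ∈ Finset.Ico (N n) (N (n + 1)), |φ (E.unitVec k)| * diag v x k

theorem sum_abs_blockSum_le (hv : Orthonormal ℂ v) (φ : E.Space →L[ℝ] ℝ) {N : ℕ → ℕ}
    (hN : Monotone N) (x : SchattenSpace E H) (m : ℕ) :
    ∑ n ∈ Finset.range m, |blockSum v φ N x n| ≤ ‖φ‖ * ‖x‖ := by
  refine le_trans ?_ (sum_abs_mul_abs_diag_le hv φ x (N m))
  induction m with
  | zero => exact Finset.sum_nonneg fun _ _ => by positivity
  | succ m ih =>
    rw [Finset.sum_range_succ, ← Finset.sum_range_add_sum_Ico _ (hN (Nat.le_succ m))]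
    refine add_le_add ih ((Finset.abs_sum_le_sum_abs _ _).trans_eq ?_)
    exact Finset.sum_congr rfl fun k _ => by rw [abs_mul, abs_abs]

theorem summable_abs_blockSum (hv : Orthonormal ℂ v) (φ : E.Space →L[ℝ] ℝ) {N : ℕ → ℕ}
    (hN : Monotone N) (x : SchattenSpace E H) : Summable fun n => |blockSum v φ N x n| :=
  summable_of_sum_range_le (fun _ => abs_nonneg _) (sum_abs_blockSum_le hv φ hN x)

theorem blockSum_add (v : ℕ → H) (φ : E.Space →L[ℝ] ℝ) (N : ℕ → ℕ) (x y : SchattenSpace E H)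
    (n : ℕ) : blockSum v φ N (x + y) n = blockSum v φ N x n + blockSum v φ N y n := by
  simp only [blockSum, diag, toOperator_add, _root_.add_apply, inner_add_left, Complex.add_re,
    mul_add, Finset.sum_add_distrib]

theorem blockSum_smul (v : ℕ → H) (φ : E.Space →L[ℝ] ℝ) (N : ℕ → ℕ) (c : ℝ)
    (x : SchattenSpace E H) (n : ℕ) : blockSum v φ N (c • x) n = c * blockSum v φ N x n := by
  simp only [blockSum, diag, toOperator_smul, _root_.smul_apply, Finset.mul_sum]
  refine Finset.sum_congr rfl fun k _ => ?_
  rw [← Complex.coe_smul, inner_smul_left, Complex.conj_ofReal, Complex.re_ofReal_mul]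
  ring

variable [TopologicalSpace.SeparableSpace E.Space]

/-- The positive operator from `S_E(H)` to `ℓ₁` given by the block sums. -/
def toEllOne (hv : Orthonormal ℂ v) (φ : E.Space →L[ℝ] ℝ) {N : ℕ → ℕ} (hN : Monotone N) :
    SchattenSpace E H →L[ℝ] lp (fun _ : ℕ => ℝ) 1 :=
  LinearMap.mkContinuous
    { toFun := fun x => ⟨blockSum v φ N x, memℓp_gen (by
        simpa using summable_abs_blockSum hv φ hN x)⟩
      map_add' := fun x y => Subtype.ext (funext fun n => blockSum_add v φ N x y n)
      map_smul' := fun c x => Subtype.ext (funext fun n => blockSum_smul v φ N c x n) }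
    ‖φ‖ fun x => by
      rw [norm_ellOne]
      exact Real.tsum_le_of_sum_range_le (fun _ => norm_nonneg _) (sum_abs_blockSum_le hv φ hN x)

theorem toEllOne_apply (hv : Orthonormal ℂ v) (φ : E.Space →L[ℝ] ℝ) {N : ℕ → ℕ} (hN : Monotone N)
    (x : SchattenSpace E H) (n : ℕ) : toEllOne hv φ hN x n = blockSum v φ N x n := rfl

/-- If `E` contains `ℓ₁`, there are a positive operator from `S_E(H)` to `ℓ₁` and a bounded sequence
mapped to the unit vectors. -/
theorem exists_toEllOne (hE : E.ContainsEllOne) (hH : ¬ FiniteDimensional ℂ H) :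
    ∃ (Q : SchattenSpace E H →L[ℝ] lp (fun _ : ℕ => ℝ) 1) (C : ℝ) (y : ℕ → SchattenSpace E H),
      (∀ x : SchattenSpace E H, x.toOperator.IsPositive → ∀ n, 0 ≤ Q x n) ∧ (∀ n, ‖y n‖ ≤ C) ∧
      ∀ n m, Q (y n) m = if m = n then 1 else 0 := by
  obtain ⟨v, hv⟩ := exists_orthonormal_nat hH
  obtain ⟨φ, C, N, b, hN, hbE, hbC, hb1⟩ := hE.exists_blocks
  have horth : ∀ n, Orthonormal ℂ fun i : Finset.Ico (N n) (N (n + 1)) => v i := fun n =>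
    hv.comp _ Subtype.val_injective
  have hmem := fun n => singularValue_diagOp_mem E (horth n) (hbE n)
    (b := fun i : Finset.Ico (N n) (N (n + 1)) => b n i) Subtype.val_injective fun _ => rfl
  let y : ℕ → SchattenSpace E H := fun n => mk _ (hmem n).1 diagOp_isSelfAdjoint
  refine ⟨toEllOne hv φ hN.monotone, C, y, fun x hx n => ?_, fun n => (hmem n).2.trans (hbC n),
    fun n m => ?_⟩
  · rw [toEllOne_apply]
    exact Finset.sum_nonneg fun k _ => mul_nonneg (abs_nonneg _) (diag_nonneg hx k)
  · rw [toEllOne_apply, blockSum]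
    have hdiag : ∀ k, k ∈ Finset.Ico (N n) (N (n + 1)) → diag v (y n) k = b n k := fun k hk => by
      have := inner_diagOp_self (b := fun i : Finset.Ico (N n) (N (n + 1)) => b n i) (horth n)
        ⟨k, hk⟩
      simp only [diag, y, toOperator_mk]
      rw [this, Complex.ofReal_re]
    have hdiag0 : ∀ k, k ∉ Finset.Ico (N n) (N (n + 1)) → diag v (y n) k = 0 := fun k hk => by
      simp only [diag, y, toOperator_mk]
      rw [inner_diagOp_of_orthogonal fun i : Finset.Ico (N n) (N (n + 1)) =>
        hv.2 fun h : (i : ℕ) = k => hk (h ▸ i.2), Complex.zero_re]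
    split_ifs with hmn
    · subst hmn
      rw [← hb1 m]
      exact Finset.sum_congr rfl fun k hk => by rw [hdiag k hk]
    · refine Finset.sum_eq_zero fun k hk => ?_
      rw [hdiag0 k fun hk' => ?_, mul_zero]
      rw [Finset.mem_Ico] at hk hk'
      rcases lt_or_gt_of_ne hmn with h | h
      · have := hN.monotone (show m + 1 ≤ n from h)
        omega
      · have := hN.monotone (show n + 1 ≤ m from h)
        omega

end SchattenSpace

/-! ### Failure of domination -/

theorem exists_not_isCompact_Icc {Z : Type*} [NormedAddCommGroup Z] [NormedSpace ℝ Z] [Lattice Z]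
    [IsOrderedAddMonoid Z] [PosSMulMono ℝ Z] [HasSolidNorm Z]
    (hZ : ¬ IsAtomicBanachLattice Z ∨ ¬ IsOrderContinuousBanachLattice Z) :
    ∃ s : Z, 0 ≤ s ∧ ¬ IsCompact (Icc 0 s) := by
  by_contra! h
  exact hZ.elim (· (isAtomicBanachLattice_of_isCompact_Icc h))
    (· (isOrderContinuousBanachLattice_of_isCompact_Icc h))

theorem exists_isDominatedBy_not_isCompactOperator {E : SymmetricSequenceSpace}
    [TopologicalSpace.SeparableSpace E.Space] {H : Type*} [NormedAddCommGroup H]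
    [InnerProductSpace ℂ H] [CompleteSpace H] (hE : E.ContainsEllOne)
    (hH : ¬ FiniteDimensional ℂ H) {Z : Type*} [NormedAddCommGroup Z] [NormedSpace ℝ Z]
    [CompleteSpace Z] [Lattice Z] [IsOrderedAddMonoid Z] [PosSMulMono ℝ Z] [HasSolidNorm Z]
    {s : Z} (hs : 0 ≤ s) (hsc : ¬ IsCompact (Icc 0 s)) :
    ∃ T S : SchattenSpace E H →L[ℝ] Z, IsDominatedBy T S ∧
      IsCompactOperator S ∧ ¬ IsCompactOperator T := by
  obtain ⟨Q, C, y, hQ, hy, hQy⟩ := SchattenSpace.exists_toEllOne hE hH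
  obtain ⟨t, ht, hnot⟩ : ∃ t : ℕ → Z, (∀ n, t n ∈ Icc 0 s) ∧
      ∀ a ∈ Icc 0 s, ∀ ψ : ℕ → ℕ, StrictMono ψ → ¬ Tendsto (t ∘ ψ) atTop (𝓝 a) := by
    rw [isCompact_iff_isSeqCompact, IsSeqCompact] at hsc
    push Not at hsc
    exact hsc
  have htn : ∀ n, ‖t n‖ ≤ ‖s‖ := fun n => by
    refine HasSolidNorm.solid ?_
    rw [abs_of_nonneg (ht n).1, abs_of_nonneg hs]
    exact (ht n).2
  let σ : lp (fun _ : ℕ => ℝ) 1 →L[ℝ] ℝ := ellOneLift (fun _ => 1) 1 fun _ => by simp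
  let T : SchattenSpace E H →L[ℝ] Z := (ellOneLift t ‖s‖ htn).comp Q
  let S : SchattenSpace E H →L[ℝ] Z :=
    (ContinuousLinearMap.toSpanSingleton ℝ s).comp (σ.comp Q)
  have hT : ∀ x, HasSum (fun n => Q x n • t n) (T x) := fun x => hasSum_ellOneLift htn (Q x)
  have hS : ∀ x, HasSum (fun n => Q x n • s) (S x) := fun x => by
    have h1 : HasSum (fun n => Q x n • (1 : ℝ)) (σ (Q x)) := hasSum_ellOneLift _ (Q x)
    have h2 := (ContinuousLinearMap.toSpanSingleton ℝ s).hasSum h1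
    simp only [smul_eq_mul, mul_one, ContinuousLinearMap.toSpanSingleton_apply] at h2
    exact h2
  refine ⟨T, S, fun x hx => ⟨?_, ?_⟩, ?_, fun hcomp => ?_⟩
  · exact (hT x).nonneg fun n => smul_nonneg (hQ x hx n) (ht n).1
  · exact hasSum_le (fun n => smul_le_smul_of_nonneg_left (ht n).2 (hQ x hx n)) (hT x) (hS x)
  · exact (isCompactOperator_of_locallyCompactSpace_dom (σ.comp Q)).clm_comp
      (ContinuousLinearMap.toSpanSingleton ℝ s)
  · have hTy : ∀ n, T (y n) = t n := fun n => by
      refine (hT (y n)).unique ?_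
      convert hasSum_single n ?_ using 1
      · rw [hQy, if_pos rfl, one_smul]
      · intro m hm
        rw [hQy, if_neg hm, zero_smul]
    have hK := hcomp.isCompact_closure_image_closedBall (f := T.toLinearMap) C
    obtain ⟨a, -, ψ, hψ, hlim⟩ := hK.tendsto_subseq (x := t) fun n =>
      subset_closure ⟨y n, by simpa using hy n, hTy n⟩
    exact hnot a (isClosed_Icc.mem_of_tendsto hlim (Eventually.of_forall fun n => ht _)) ψ hψ hlim

end

theorem mainTheorem8 (E : SymmetricSequenceSpace) [TopologicalSpace.SeparableSpace E.Space]
    (H : Type*) [NormedAddCommGroup H] [InnerProductSpace ℂ H] [CompleteSpace H] :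
    (¬ E.ContainsEllOne →
      ∀ (Z : Type*) [NormedAddCommGroup Z] [NormedSpace ℝ Z] [CompleteSpace Z]
        [PartialOrder Z] [IsOrderedAddMonoid Z] [PosSMulMono ℝ Z],
        IsClosed {z : Z | 0 ≤ z} → IsNormalOrdered Z →
        ∀ T S : SchattenSpace E H →L[ℝ] Z, IsDominatedBy T S →
          IsCompactOperator (ContinuousLinearMap.precomp ℝ S :
            (Z →L[ℝ] ℝ) →L[ℝ] (SchattenSpace E H →L[ℝ] ℝ)) →
          IsCompactOperator (ContinuousLinearMap.precomp ℝ T :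
            (Z →L[ℝ] ℝ) →L[ℝ] (SchattenSpace E H →L[ℝ] ℝ))) ∧
    (E.ContainsEllOne → ¬ FiniteDimensional ℂ H →
      ∀ (Z : Type*) [NormedAddCommGroup Z] [NormedSpace ℝ Z] [CompleteSpace Z]
        [Lattice Z] [IsOrderedAddMonoid Z] [PosSMulMono ℝ Z] [HasSolidNorm Z],
        (¬ IsAtomicBanachLattice Z ∨ ¬ IsOrderContinuousBanachLattice Z) →
        ∃ T S : SchattenSpace E H →L[ℝ] Z, IsDominatedBy T S ∧
          IsCompactOperator S ∧ ¬ IsCompactOperator T) := by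
  refine ⟨fun hE Z _ _ _ _ _ _ _ hZ T S hTS hS =>
    isCompactOperator_precomp_of_isDominatedBy hE hZ hTS hS, fun hE hH Z _ _ _ _ _ _ _ hZ => ?_⟩
  obtain ⟨s, hs, hsc⟩ := exists_not_isCompact_Icc hZ
  exact exists_isDominatedBy_not_isCompactOperator hE hH hs hsc
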